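/- Let $z_0,\dots,z_3$ be the coordinates of $\mathbb{C}^4$, $\pi:\mathbb{C}^4\setminus\{0\}\to\mathbb{CP}^3$ the projection, $E$ the unit matrix. For $q\ge 1$ let $S^q\mathbb{C}^4\otimes\wedge^q(\mathbb{C}^4)^\vee$ be the space of arrays $a=(a_{i_1\dots i_q k_1\dots k_q})$ of complex numbers (indices in $\{0,\dots,3\}$) that are symmetric in the $i$'s and antisymmetric in the $k$'s, and let $S^q\otimes\wedge^q$ be the projection of $\otimes^q gl(4,\mathbb{C})\cong(\otimes^q\mathbb{C}^4)\otimes(\otimes^q(\mathbb{C}^4)^\vee)$ onto it (symmetrization in the $i$'s, antisymmetrization in the $k$'s). To $a$ belongs the $\mathbb{C}^*$-invariant holomorphic $q$-vector $w_a=\sum a_{i_1\dots i_qk_1\dots k_q}z_{i_1}\cdots z_{i_q}\,\frac{\partial}{\partial z_{k_1}}\wedge\dots\wedge\frac{\partial}{\partial z_{k_q}}$ on $\mathbb{C}^4\setminus\{0\}$. Put $$Q_2=S^2\mathbb{C}^4\otimes\wedge^2(\mathbb{C}^4)^\vee\,/\,S^2\otimes\wedge^2\bigl(sl(4,\mathbb{C})\otimes\langle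 E\rangle\bigr),\qquad Q_3=S^3\mathbb{C}^4\otimes\wedge^3(\mathbb{C}^4)^\vee\,/\,S^3\otimes\wedge^3\bigl(\otimes^2sl(4,\mathbb{C})\otimes\langle E\rangle\bigr).$$ For $a,a'\in S^2\mathbb{C}^4\otimes\wedge^2(\mathbb{C}^4)^\vee$ let $A_{jl}$, $A'_{jl}$ be the matrices with $(i,k)$-entries $a_{ijkl}$, $a'_{ijkl}$, and let $\widetilde F(a,a')=S^3\otimes\wedge^3(4[A_{jl},A'_{j'l'}])\in S^3\mathbb{C}^4\otimes\wedge^3(\mathbb{C}^4)^\vee$. The Schouten bracket of $2$-vectors is normalized by $[X\wedge Y,X'\wedge Y']=[X,X']\wedge Y\wedge Y'-[X,Y']\wedge Y\wedge X'-[Y,X']\wedge X\wedge Y'+[Y,Y']\wedge X\wedge X'$ for vector fields $X,Y,X',Y'$. A holomorphic Poisson structure on $\mathbb{CP}^3$ is a holomorphic $2$-vector $\theta$ on $\mathbb{CP}^3$ with $[\theta,\theta]=0$. Then $[w_a,w_{a'}]=w_{\widetilde F(a,a')}$ for all $a,a'$, and $\widetilde F$ induces a bilinear map $F:Q_2\times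 Q_2\to Q_3$. Moreover $a\mapsto d\pi(w_a)$ induces a linear isomorphism $\Phi_2$ of $Q_2$ onto the space of holomorphic $2$-vectors on $\mathbb{CP}^3$ and an injective linear map $\Phi_3$ of $Q_3$ into the space of holomorphic $3$-vectors on $\mathbb{CP}^3$, such that $[\Phi_2(x),\Phi_2(y)]=\Phi_3(F(x,y))$ for all $x,y\in Q_2$. Consequently $\Phi_2$ identifies $$\{a\in Q_2\mid F(a,a)=0\}$$ with the space of holomorphic Poisson structures on $\mathbb{CP}^3$. -/

import Mathlib

namespace CP3

/-! ### Coordinate multivectors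

A `q`-vector on the coordinate space `ι → ℂ` at a point is the array `t` of its antisymmetric
coefficients, standing for `∑ t (i₁, …, i_q) ∂_{i₁} ∧ ⋯ ∧ ∂_{i_q}` (sum over all index tuples). -/

/-- Antisymmetry of the coefficients of a `q`-vector. -/
def IsAntisymm {ι : Type} {q : ℕ} (t : (Fin q → ι) → ℂ) : Prop :=
  ∀ (τ : Equiv.Perm (Fin q)) (k : Fin q → ι), t (k ∘ τ) = ((Equiv.Perm.sign τ : ℤ) : ℂ) * t k

/-- Antisymmetrization: `∑ t k ∂_{k₁} ∧ ⋯ ∧ ∂_{k_q}`, for an arbitrary array `t`, has the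
antisymmetric coefficients `alternate t`. -/
noncomputable def alternate {ι : Type} {q : ℕ} (t : (Fin q → ι) → ℂ) : (Fin q → ι) → ℂ :=
  fun k => (Nat.factorial q : ℂ)⁻¹ *
    ∑ τ : Equiv.Perm (Fin q), ((Equiv.Perm.sign τ : ℤ) : ℂ) * t (k ∘ τ)

/-- The map `⋀^q L` induced on `q`-vectors by a linear map `L`. -/
noncomputable def pushMultivector {ι κ : Type} [Fintype ι] [DecidableEq ι] [Fintype κ] {q : ℕ}
    (L : (ι → ℂ) →L[ℂ] (κ → ℂ)) (t : (Fin q → ι) → ℂ) : (Fin q → κ) → ℂ :=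
  fun k => ∑ i : Fin q → ι, (∏ m, L (Pi.single (i m) 1) (k m)) * t i

/-- The coordinate partial derivative `∂f / ∂x_i` at `x`. -/
noncomputable def partialDeriv {ι : Type} [Fintype ι] [DecidableEq ι]
    (i : ι) (f : (ι → ℂ) → ℂ) (x : ι → ℂ) : ℂ :=
  fderiv ℂ f x (Pi.single i 1)

/-- The Schouten bracket of two 2-vector fields on a coordinate space: the bilinear extension of
`[f ∂_i ∧ ∂_j, g ∂_k ∧ ∂_l] = -(f (∂_i g) ∂_j ∧ ∂_k ∧ ∂_l - f (∂_j g) ∂_i ∧ ∂_k ∧ ∂_l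
  + g (∂_k f) ∂_i ∧ ∂_j ∧ ∂_l - g (∂_l f) ∂_i ∧ ∂_j ∧ ∂_k)`.
The overall sign is the one for which `[X ∧ Y, X' ∧ Y']` equals
`[X, X'] ∧ Y ∧ Y' - [X, Y'] ∧ Y ∧ X' - [Y, X'] ∧ X ∧ Y' + [Y, Y'] ∧ X ∧ X'`, with the Lie bracket
of vector fields on the right. -/
noncomputable def schouten {ι : Type} [Fintype ι] [DecidableEq ι]
    (θ η : (ι → ℂ) → (Fin 2 → ι) → ℂ) : (ι → ℂ) → (Fin 3 → ι) → ℂ :=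
  fun x => alternate fun k =>
    -∑ i : ι,
      (θ x ![i, k 0] * partialDeriv i (fun y => η y ![k 1, k 2]) x
        - θ x ![k 0, i] * partialDeriv i (fun y => η y ![k 1, k 2]) x
        + η x ![i, k 2] * partialDeriv i (fun y => θ y ![k 0, k 1]) x
        - η x ![k 2, i] * partialDeriv i (fun y => θ y ![k 0, k 1]) x)

/-! ### Projective space and its affine charts -/

/-- Complex projective 3-space. -/
abbrev CPThree : Type := Projectivization ℂ (Fin 4 → ℂ)

/-- The index set of the inhomogeneous coordinates on `U_r`. -/
abbrev Idx (r : Fin 4) : Type := {i : Fin 4 // i ≠ r}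

/-- Inhomogeneous coordinates `z_i / z_r` (`i ≠ r`), as functions on `ℂ⁴`. -/
noncomputable def affineCoord (r : Fin 4) (z : Fin 4 → ℂ) : Idx r → ℂ :=
  fun i => z i / z r

theorem affineCoord_smul (r : Fin 4) (c : ℂ) (hc : c ≠ 0) (z : Fin 4 → ℂ) :
    affineCoord r (c • z) = affineCoord r z := by
  funext i
  simp [affineCoord, mul_div_mul_left _ _ hc]

/-- The open set `U_r = {[z] | z_r ≠ 0}`. -/
def affineOpen (r : Fin 4) : Set CPThree := {p | p.rep r ≠ 0}

/-- The affine chart `U_r → ℂ³`, `[z] ↦ (z_i / z_r)`. -/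
noncomputable def chart (r : Fin 4) (p : CPThree) : Idx r → ℂ :=
  Projectivization.lift (fun v : {v : Fin 4 → ℂ // v ≠ 0} => affineCoord r v.1)
    (by
      rintro ⟨a, ha⟩ ⟨b, hb⟩ t h
      have h' : a = t • b := h
      have ht : t ≠ 0 := by
        rintro rfl
        exact ha (by simpa using h')
      change affineCoord r a = affineCoord r b
      rw [h', affineCoord_smul r t ht]) p

/-- The vector of `ℂ⁴` with `r`-th entry `1` and the other entries `ζ`. -/
def affineVec (r : Fin 4) (ζ : Idx r → ℂ) : Fin 4 → ℂ :=
  fun i => if h : i = r then 1 else ζ ⟨i, h⟩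

theorem affineVec_ne_zero (r : Fin 4) (ζ : Idx r → ℂ) : affineVec r ζ ≠ 0 := by
  intro h
  have := congrFun h r
  simp [affineVec] at this

/-- The inverse `ℂ³ → U_r` of the affine chart. -/
noncomputable def chartInv (r : Fin 4) (ζ : Idx r → ℂ) : CPThree :=
  Projectivization.mk ℂ (affineVec r ζ) (affineVec_ne_zero r ζ)

/-- The change of coordinates from the chart on `U_r` to the chart on `U_s`. -/
noncomputable def transition (r s : Fin 4) (ζ : Idx r → ℂ) : Idx s → ℂ :=
  chart s (chartInv r ζ)

theorem alternating_add {ι : Type} {q : ℕ} {s t : (Fin q → ι) → ℂ}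
    (hs : IsAntisymm s) (ht : IsAntisymm t) : IsAntisymm (s + t) := by
  intro τ k
  simp [hs τ k, ht τ k, mul_add]

theorem pushMultivector_add {ι κ : Type} [Fintype ι] [DecidableEq ι] [Fintype κ] {q : ℕ}
    (L : (ι → ℂ) →L[ℂ] (κ → ℂ)) (s t : (Fin q → ι) → ℂ) :
    pushMultivector L (s + t) = pushMultivector L s + pushMultivector L t := by
  funext k
  simp [pushMultivector, mul_add, Finset.sum_add_distrib]

theorem pushMultivector_smul {ι κ : Type} [Fintype ι] [DecidableEq ι] [Fintype κ] {q : ℕ}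
    (L : (ι → ℂ) →L[ℂ] (κ → ℂ)) (c : ℂ) (t : (Fin q → ι) → ℂ) :
    pushMultivector L (c • t) = c • pushMultivector L t := by
  funext k
  simp only [pushMultivector, Pi.smul_apply, smul_eq_mul, Finset.mul_sum]
  exact Finset.sum_congr rfl fun i _ => by ring

/-- The space of holomorphic `q`-vectors on `ℂP³`, i.e. of global holomorphic sections of the
`q`-th exterior power of the holomorphic tangent bundle. A section `θ` is given by its
coefficient functions `θ r` in the affine charts `U_r ≅ ℂ³`; these are antisymmetric,
holomorphic, and transform on `U_r ∩ U_s` by the differential of the change of coordinates. -/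
noncomputable def HolMultivector (q : ℕ) :
    Submodule ℂ ((r : Fin 4) → (Idx r → ℂ) → (Fin q → Idx r) → ℂ) where
  carrier := {θ | (∀ r ζ, IsAntisymm (θ r ζ)) ∧
    (∀ r k, Differentiable ℂ fun ζ => θ r ζ k) ∧
    ∀ r s, ∀ p ∈ affineOpen r ∩ affineOpen s,
      θ s (chart s p) =
        pushMultivector (fderiv ℂ (transition r s) (chart r p)) (θ r (chart r p))}
  zero_mem' := by
    refine ⟨fun r ζ τ k => by simp, fun r k => by simp, fun r s p _ => ?_⟩
    funext k
    simp [pushMultivector]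
  add_mem' := by
    rintro a b ⟨ha, ha', ha''⟩ ⟨hb, hb', hb''⟩
    refine ⟨fun r ζ => alternating_add (ha r ζ) (hb r ζ),
      fun r k => (ha' r k).add (hb' r k), fun r s p hp => ?_⟩
    simp only [Pi.add_apply, pushMultivector_add, ha'' r s p hp, hb'' r s p hp]
  smul_mem' := by
    rintro c a ⟨ha, ha', ha''⟩
    refine ⟨fun r ζ τ k => ?_, fun r k => (ha' r k).const_smul c, fun r s p hp => ?_⟩
    · simp only [Pi.smul_apply, smul_eq_mul, ha r ζ τ k]
      ring
    · simp only [Pi.smul_apply, pushMultivector_smul, ha'' r s p hp]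

/-- A holomorphic Poisson structure on `ℂP³`: a holomorphic 2-vector whose Schouten bracket with
itself vanishes (in every chart). -/
def IsPoisson (θ : HolMultivector 2) : Prop :=
  ∀ r, schouten (θ.1 r) (θ.1 r) = 0

/-- `θ = dπ(w)`, for the projection `π : ℂ⁴ ∖ {0} → ℂP³` and a `q`-vector field `w` on
`ℂ⁴ ∖ {0}`: in the chart on `U_r`, where `π` reads `z ↦ (z_i / z_r)`, the value of `θ` at `π z` is
the image of `w z` under the differential of `π` at `z`. -/
def IsPushforward {q : ℕ} (w : (Fin 4 → ℂ) → (Fin q → Fin 4) → ℂ) (θ : HolMultivector q) : Prop :=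
  ∀ (r : Fin 4) (z : Fin 4 → ℂ) (hz : z ≠ 0), z r ≠ 0 →
    θ.1 r (chart r (Projectivization.mk ℂ z hz)) =
      pushMultivector (fderiv ℂ (affineCoord r) z) (w z)

/-! ### Tensors -/

/-- The tensor space `⊗^q gl(4, ℂ) = (⊗^q ℂ⁴) ⊗ (⊗^q (ℂ⁴)^∨)`: arrays `t i k`, with upper indices
`i = (i₁, …, i_q)` and lower indices `k = (k₁, …, k_q)`. -/
abbrev GlTensor (q : ℕ) : Type := (Fin q → Fin 4) → (Fin q → Fin 4) → ℂ

/-- `S^q ℂ⁴ ⊗ ⋀^q (ℂ⁴)^∨`: the tensors symmetric in `i` and antisymmetric in `k`. -/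
def SymAlt (q : ℕ) : Submodule ℂ (GlTensor q) where
  carrier := {t | ∀ (σ τ : Equiv.Perm (Fin q)) (i k : Fin q → Fin 4),
    t (i ∘ σ) (k ∘ τ) = ((Equiv.Perm.sign τ : ℤ) : ℂ) * t i k}
  zero_mem' := fun σ τ i k => by simp
  add_mem' := fun {a b} ha hb σ τ i k => by
    simp only [Pi.add_apply, ha σ τ i k, hb σ τ i k, mul_add]
  smul_mem' := fun c a ha σ τ i k => by
    simp only [Pi.smul_apply, smul_eq_mul, ha σ τ i k]
    ring

/-- The coefficients of the projection of `t` to the tensors symmetric in `i` and antisymmetric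
in `k`. -/
noncomputable def symAltCoeff {q : ℕ} (t : GlTensor q) : GlTensor q :=
  fun i k => ((Nat.factorial q : ℂ) ^ 2)⁻¹ *
    ∑ σ : Equiv.Perm (Fin q), ∑ τ : Equiv.Perm (Fin q),
      ((Equiv.Perm.sign τ : ℤ) : ℂ) * t (i ∘ σ) (k ∘ τ)

theorem symAltCoeff_mem {q : ℕ} (t : GlTensor q) : symAltCoeff t ∈ SymAlt q := by
  intro α β i k
  have hs : ((Equiv.Perm.sign β : ℤ) : ℂ) * ((Equiv.Perm.sign β : ℤ) : ℂ) = 1 := by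
    rw [← Int.cast_mul, ← Units.val_mul, Int.units_mul_self]
    simp
  have h1 : ∀ u : Fin q → Fin 4,
      ∑ τ : Equiv.Perm (Fin q), ((Equiv.Perm.sign τ : ℤ) : ℂ) * t u (k ∘ τ) =
        ((Equiv.Perm.sign β : ℤ) : ℂ) *
          ∑ τ : Equiv.Perm (Fin q), ((Equiv.Perm.sign τ : ℤ) : ℂ) * t u ((k ∘ β) ∘ τ) := by
    intro u
    rw [Finset.mul_sum]
    refine (Fintype.sum_equiv (Equiv.mulLeft β) _ _ fun τ => ?_).symm
    simp only [Equiv.coe_mulLeft, Equiv.Perm.sign_mul, Units.val_mul, Int.cast_mul,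
      Equiv.Perm.coe_mul, ← mul_assoc, Function.comp_assoc]
  have h2 : ∑ σ : Equiv.Perm (Fin q), ∑ τ : Equiv.Perm (Fin q),
        ((Equiv.Perm.sign τ : ℤ) : ℂ) * t ((i ∘ α) ∘ σ) ((k ∘ β) ∘ τ) =
      ∑ σ : Equiv.Perm (Fin q), ∑ τ : Equiv.Perm (Fin q),
        ((Equiv.Perm.sign τ : ℤ) : ℂ) * t (i ∘ σ) ((k ∘ β) ∘ τ) := by
    refine Fintype.sum_equiv (Equiv.mulLeft α) _ _ fun σ => ?_
    simp only [Equiv.coe_mulLeft, Equiv.Perm.coe_mul, Function.comp_assoc]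
  simp only [symAltCoeff]
  rw [h2]
  simp only [h1]
  rw [← Finset.mul_sum, mul_left_comm, ← mul_assoc ((Equiv.Perm.sign β : ℤ) : ℂ) _ (Finset.sum _ _),
    hs, one_mul]

/-- The projection `S^q ⊗ ⋀^q` of `⊗^q gl(4, ℂ)` onto `S^q ℂ⁴ ⊗ ⋀^q (ℂ⁴)^∨`. -/
noncomputable def symAltProj (q : ℕ) : GlTensor q →ₗ[ℂ] SymAlt q where
  toFun t := ⟨symAltCoeff t, symAltCoeff_mem t⟩
  map_add' s t := by
    apply Subtype.ext
    funext i k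
    simp [symAltCoeff, mul_add, Finset.sum_add_distrib]
  map_smul' c t := by
    apply Subtype.ext
    funext i k
    simp only [symAltCoeff, Pi.smul_apply, smul_eq_mul, RingHom.id_apply, Submodule.coe_smul,
      Finset.mul_sum]
    refine Finset.sum_congr rfl fun σ _ => Finset.sum_congr rfl fun τ _ => by ring

/-- The decomposable tensor `B₁ ⊗ ⋯ ⊗ B_q` of matrices. -/
def pureTensor {q : ℕ} (B : Fin q → Matrix (Fin 4) (Fin 4) ℂ) : GlTensor q :=
  fun i k => ∏ m, B m (i m) (k m)

/-- The subspace `(⊗^n sl(4, ℂ)) ⊗ ⟨E⟩` of `⊗^(n+1) gl(4, ℂ)`, where `E` is the unit matrix. -/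
def slTensorE (n : ℕ) : Submodule ℂ (GlTensor (n + 1)) :=
  Submodule.span ℂ {t | ∃ B : Fin (n + 1) → Matrix (Fin 4) (Fin 4) ℂ,
    (∀ m : Fin n, B m.castSucc ∈ LieAlgebra.SpecialLinear.sl (Fin 4) ℂ) ∧
    B (Fin.last n) ∈ Submodule.span ℂ {(1 : Matrix (Fin 4) (Fin 4) ℂ)} ∧ t = pureTensor B}

/-- The subspace `S^(n+1) ⊗ ⋀^(n+1) ((⊗^n sl(4, ℂ)) ⊗ ⟨E⟩)` of `S^(n+1) ℂ⁴ ⊗ ⋀^(n+1) (ℂ⁴)^∨`. -/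
noncomputable def eulerPart (n : ℕ) : Submodule ℂ (SymAlt (n + 1)) :=
  (slTensorE n).map (symAltProj (n + 1))

/-- The `ℂ^*`-invariant `q`-vector field
`∑ a i k z_{i₁} ⋯ z_{i_q} ∂/∂z_{k₁} ∧ ⋯ ∧ ∂/∂z_{k_q}` on `ℂ⁴` (hence on `ℂ⁴ ∖ {0}`). -/
def toField {q : ℕ} (a : SymAlt q) : (Fin 4 → ℂ) → (Fin q → Fin 4) → ℂ :=
  fun z k => ∑ i : Fin q → Fin 4, a.1 i k * ∏ m, z (i m)

/-- The matrix `A_{jl}` with `(i, k)`-entry `a_{ijkl}`. -/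
def blockMatrix (a : SymAlt 2) (j l : Fin 4) : Matrix (Fin 4) (Fin 4) ℂ :=
  Matrix.of fun i k => a.1 ![i, j] ![k, l]

/-- The element `[A_{jl}, A'_{j'l'}]` of `⊗³ gl(4, ℂ)`, made of commutators of matrices. -/
def bracketTensor (a a' : SymAlt 2) : GlTensor 3 :=
  fun i k => ⁅blockMatrix a (i 1) (k 1), blockMatrix a' (i 2) (k 2)⁆ (i 0) (k 0)

theorem blockMatrix_add (a b : SymAlt 2) (j l : Fin 4) :
    blockMatrix (a + b) j l = blockMatrix a j l + blockMatrix b j l := by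
  ext i k
  simp [blockMatrix]

theorem blockMatrix_smul (c : ℂ) (a : SymAlt 2) (j l : Fin 4) :
    blockMatrix (c • a) j l = c • blockMatrix a j l := by
  ext i k
  simp [blockMatrix]

/-- The bilinear map `F̃(a, a') = S³ ⊗ ⋀³ (4 [A_{jl}, A'_{j'l'}])`. -/
noncomputable def Ftilde : SymAlt 2 →ₗ[ℂ] SymAlt 2 →ₗ[ℂ] SymAlt 3 :=
  LinearMap.mk₂ ℂ (fun a a' => symAltProj 3 ((4 : ℂ) • bracketTensor a a'))
    (fun a b c => by
      rw [← map_add, ← smul_add]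
      congr 2
      funext i k
      simp only [bracketTensor, blockMatrix_add, Ring.lie_def, add_mul, mul_add, Matrix.add_apply,
        Matrix.sub_apply, Pi.add_apply]
      ring)
    (fun c a b => by
      rw [← map_smul, smul_comm c]
      congr 2
      funext i k
      simp only [bracketTensor, blockMatrix_smul, Ring.lie_def, smul_mul_assoc, mul_smul_comm,
        Matrix.smul_apply, Matrix.sub_apply, Pi.smul_apply, smul_eq_mul]
      ring)
    (fun a b c => by
      rw [← map_add, ← smul_add]
      congr 2
      funext i k
      simp only [bracketTensor, blockMatrix_add, Ring.lie_def, add_mul, mul_add, Matrix.add_apply,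
        Matrix.sub_apply, Pi.add_apply]
      ring)
    (fun c a b => by
      rw [← map_smul, smul_comm c]
      congr 2
      funext i k
      simp only [bracketTensor, blockMatrix_smul, Ring.lie_def, smul_mul_assoc, mul_smul_comm,
        Matrix.smul_apply, Matrix.sub_apply, Pi.smul_apply, smul_eq_mul]
      ring)

end CP3

namespace CP3

/-! ### Forms given by arrays of coefficients -/

/-! Everything is governed by the exterior product with the Euler field z. In the chart U_r, dπ
sends a bivector or trivector w at z to those components of z ∧ w that carry the index r, divided by
a power of z_r (`pushMultivector_affineCoord_two`, `pushMultivector_affineCoord_three`). Since z ∧ z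
∧ w = 0, these components determine the others, so dπ(w) = 0 exactly when z ∧ w = 0.

Kernel. If z ∧ w_a = 0 identically, the divergence of this identity and Euler's formula give 4 w_a =
z ∧ div w_a, and div w_a comes from a contraction of a. Hence a is the projection of a multiple of c
⊗ E for some c. The other factors can be made traceless, because a tensor with two factors E dies
under antisymmetrization. Conversely, a factor E evaluates to the Euler field, which dπ kills. This
gives `ker_pushforwardMap_two` and `ker_pushforwardMap_three`.

Surjectivity on bivectors. A holomorphic θ lifts over each U_r to a bivector of degree 2. Two lifts
differ by an element of the kernel of dπ, so the trivectors z ∧ (lift) glue on ℂ⁴ ∖ {0}. The result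
is homogeneous of degree 3, hence differentiable at 0 and then polynomial
(`exists_tensorEval_of_homogeneous`). It is annihilated by z ∧, so the divergence identity writes it
as z ∧ w_a, and a maps to θ (`pushforwardMap_two_surjective`).

Bracket. On ℂ⁴ the bracket of w_a and w_a' differentiates quadratic coefficients, and the
contraction over the derivative index is a matrix product; its two halves form the commutator
(`schouten_toField`). The Schouten bracket is natural under holomorphic maps, because the
second-order terms cancel (`schouten_push`). So the formula descends along π, and with the
description of the kernels F̃ descends to the quotients. Poisson structures correspond to F(x, x) =
0 by injectivity of Φ₃. -/

/-- The value at `z` of the form of degree `n` with coefficient array `c`. -/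
def tensorEval {n : ℕ} (c : (Fin n → Fin 4) → ℂ) (z : Fin 4 → ℂ) : ℂ :=
  ∑ i : Fin n → Fin 4, c i * ∏ m, z (i m)

/-- Symmetry of an array in its indices. -/
def IsSymm {n : ℕ} (c : (Fin n → Fin 4) → ℂ) : Prop :=
  ∀ (σ : Equiv.Perm (Fin n)) (i : Fin n → Fin 4), c (i ∘ σ) = c i

theorem tensorEval_succ {n : ℕ} (c : (Fin (n + 1) → Fin 4) → ℂ) (z : Fin 4 → ℂ) :
    tensorEval c z = ∑ l, z l * tensorEval (fun i => c (Fin.cons l i)) z := by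
  unfold tensorEval
  rw [← (Fin.consEquiv (fun _ : Fin (n + 1) => Fin 4)).sum_comp, Fintype.sum_prod_type]
  refine Finset.sum_congr rfl fun l _ => ?_
  rw [Finset.mul_sum]
  refine Finset.sum_congr rfl fun i _ => ?_
  change c (Fin.cons l i) * ∏ m, (z ((Fin.cons l i : Fin (n + 1) → Fin 4) m)) = _
  simp only [Fin.prod_univ_succ, Fin.cons_zero, Fin.cons_succ]
  ring

theorem tensorEval_zero (c : (Fin 0 → Fin 4) → ℂ) (z : Fin 4 → ℂ) (e : Fin 0 → Fin 4) :
    tensorEval c z = c e := by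
  rw [tensorEval, Fintype.sum_unique, Fin.prod_univ_zero, mul_one]
  exact congrArg c (Subsingleton.elim _ _)

theorem differentiable_tensorEval {n : ℕ} (c : (Fin n → Fin 4) → ℂ) :
    Differentiable ℂ (tensorEval c) := by
  unfold tensorEval
  fun_prop

theorem tensorEval_sub {n : ℕ} (c d : (Fin n → Fin 4) → ℂ) (z : Fin 4 → ℂ) :
    tensorEval (c - d) z = tensorEval c z - tensorEval d z := by
  simp [tensorEval, sub_mul]

theorem tensorEval_const_mul {n : ℕ} (r : ℂ) (c : (Fin n → Fin 4) → ℂ) (z : Fin 4 → ℂ) :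
    tensorEval (fun i => r * c i) z = r * tensorEval c z := by
  simp [tensorEval, mul_assoc, Finset.mul_sum]

theorem tensorEval_sum {n : ℕ} {κ : Type} (s : Finset κ) (c : κ → (Fin n → Fin 4) → ℂ)
    (z : Fin 4 → ℂ) :
    tensorEval (fun i => ∑ x ∈ s, c x i) z = ∑ x ∈ s, tensorEval (c x) z := by
  simp only [tensorEval, Finset.sum_mul]
  exact Finset.sum_comm

theorem tensorEval_smul {n : ℕ} (c : (Fin n → Fin 4) → ℂ) (r : ℂ) (z : Fin 4 → ℂ) :
    tensorEval c (r • z) = r ^ n * tensorEval c z := by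
  simp only [tensorEval, Finset.mul_sum, Pi.smul_apply, smul_eq_mul, Finset.prod_mul_distrib,
    Finset.prod_const, Finset.card_univ, Fintype.card_fin]
  exact Finset.sum_congr rfl fun i _ => by ring

theorem IsSymm.cons {n : ℕ} {c : (Fin (n + 1) → Fin 4) → ℂ} (hc : IsSymm c) (l : Fin 4) :
    IsSymm fun i : Fin n → Fin 4 => c (Fin.cons l i) := by
  intro σ i
  have h : (Fin.cons l (i ∘ σ) : Fin (n + 1) → Fin 4) =
      (Fin.cons l i : Fin (n + 1) → Fin 4) ∘ (Equiv.Perm.decomposeFin.symm (0, σ)) := by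
    funext m
    refine Fin.cases ?_ (fun m => ?_) m
    · simp
    · simp
  simp only [h, hc _ _]

theorem IsSymm.cons_cons {n : ℕ} {c : (Fin (n + 2) → Fin 4) → ℂ} (hc : IsSymm c) (j l : Fin 4)
    (i : Fin n → Fin 4) :
    c (Fin.cons l (Fin.cons j i : Fin (n + 1) → Fin 4)) =
      c (Fin.cons j (Fin.cons l i : Fin (n + 1) → Fin 4)) := by
  rw [← hc (Equiv.swap 0 1)]
  congr 1
  funext m
  refine Fin.cases ?_ (fun m => Fin.cases ?_ (fun m => ?_) m) m
  · simp
  · simp [show (Fin.succ 0 : Fin (n + 2)) = 1 from rfl]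
  · have h0 : m.succ.succ ≠ 0 := Fin.succ_ne_zero _
    have h1 : m.succ.succ ≠ 1 := fun h => Fin.succ_ne_zero m (Fin.succ_injective _ h)
    simp [Equiv.swap_apply_of_ne_of_ne h0 h1]

theorem partialDeriv_coord (j l : Fin 4) (z : Fin 4 → ℂ) :
    partialDeriv j (fun y : Fin 4 → ℂ => y l) z = if l = j then 1 else 0 := by
  have : HasFDerivAt (fun y : Fin 4 → ℂ => y l)
      (ContinuousLinearMap.proj (R := ℂ) (φ := fun _ : Fin 4 => ℂ) l) z :=
    hasFDerivAt_apply l z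
  simp [partialDeriv, this.fderiv, Pi.single_apply]

section
variable {ι : Type} [Fintype ι] [DecidableEq ι]

theorem partialDeriv_mul {f g : (ι → ℂ) → ℂ} {z : ι → ℂ} (j : ι)
    (hf : DifferentiableAt ℂ f z) (hg : DifferentiableAt ℂ g z) :
    partialDeriv j (fun y => f y * g y) z = f z * partialDeriv j g z + partialDeriv j f z * g z := by
  simp only [partialDeriv, fderiv_fun_mul hf hg]
  simp
  ring

theorem partialDeriv_sum {κ : Type} (s : Finset κ) {f : κ → (ι → ℂ) → ℂ} {z : ι → ℂ} (j : ι)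
    (hf : ∀ x ∈ s, DifferentiableAt ℂ (f x) z) :
    partialDeriv j (fun y => ∑ x ∈ s, f x y) z = ∑ x ∈ s, partialDeriv j (f x) z := by
  simp only [partialDeriv, fderiv_fun_sum hf]
  simp

end

/-- Induction on the degree: after splitting off one variable, the product rule gives one slice from
that variable and n + 1 more from the remaining form. Symmetry moves the index j to the front. -/
theorem partialDeriv_tensorEval : ∀ {n : ℕ} {c : (Fin (n + 1) → Fin 4) → ℂ} (_ : IsSymm c)
    (j : Fin 4) (z : Fin 4 → ℂ),
    partialDeriv j (tensorEval c) z = (n + 1) * tensorEval (fun i => c (Fin.cons j i)) z := by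
  intro n
  induction n with
  | zero =>
    intro c hc j z
    have h : tensorEval c = fun y => ∑ l, y l * c (Fin.cons l default) := by
      funext y
      rw [tensorEval_succ]
      simp only [tensorEval_zero _ y default]
    rw [h, partialDeriv_sum _ _ (fun x _ => by fun_prop)]
    have h2 : ∀ l, partialDeriv j (fun y : Fin 4 → ℂ => y l * c (Fin.cons l default)) z =
        if l = j then c (Fin.cons l default) else 0 := by
      intro l
      rw [partialDeriv_mul _ (by fun_prop) (by fun_prop), partialDeriv_coord]
      simp [partialDeriv]
    simp only [h2, tensorEval_zero _ z default]
    simp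
  | succ n ih =>
    intro c hc j z
    have h : tensorEval c = fun y => ∑ l, y l * tensorEval (fun i => c (Fin.cons l i)) y := by
      funext y
      rw [tensorEval_succ]
    have hd := fun l => differentiable_tensorEval (fun i => c (Fin.cons l i))
    rw [h, partialDeriv_sum (f := fun l y => y l * tensorEval (fun i => c (Fin.cons l i)) y) _ _
      (fun x _ => DifferentiableAt.fun_mul (by fun_prop) (hd x z))]
    have h2 : ∀ l, partialDeriv j (fun y : Fin 4 → ℂ => y l *
        tensorEval (fun i => c (Fin.cons l i)) y) z =
        (n + 1) * (z l * tensorEval (fun i => c (Fin.cons j (Fin.cons l i : Fin (n + 1) → Fin 4))) z)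
        + if l = j then tensorEval (fun i => c (Fin.cons j i)) z else 0 := by
      intro l
      rw [partialDeriv_mul _ (by fun_prop) (hd l z), partialDeriv_coord]
      have := ih (hc.cons l) j z
      simp only [hc.cons_cons j l] at this
      rw [this]
      split_ifs with hl
      · subst hl; ring
      · ring
    simp only [h2, Finset.sum_add_distrib, ← Finset.mul_sum]
    rw [← tensorEval_succ (fun i => c (Fin.cons j i)) z]
    simp
    ring

/-- The slices of the array are, up to a nonzero factor, the arrays of the partial derivatives,
which vanish too; so induction on the degree applies. -/
theorem IsSymm.eq_zero_of_tensorEval : ∀ {n : ℕ} {c : (Fin n → Fin 4) → ℂ} (_ : IsSymm c)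
    (_ : ∀ z, tensorEval c z = 0), c = 0 := by
  intro n
  induction n with
  | zero =>
    intro c _ h
    funext i
    have := h 0
    rwa [tensorEval_zero _ 0 i] at this
  | succ n ih =>
    intro c hc h
    have h0 : tensorEval c = fun _ => 0 := funext h
    have key : ∀ j, (fun i : Fin n → Fin 4 => c (Fin.cons j i)) = 0 := by
      intro j
      refine ih (hc.cons j) fun z => ?_
      have h1 := partialDeriv_tensorEval hc j z
      rw [h0] at h1
      have h2 : partialDeriv j (fun _ : Fin 4 → ℂ => (0 : ℂ)) z = 0 := by simp [partialDeriv]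
      rw [h2] at h1
      have h3 : (n + 1 : ℂ) ≠ 0 := Nat.cast_add_one_ne_zero n
      exact (mul_eq_zero.1 h1.symm).resolve_left h3
    funext i
    have := congrFun (key (i 0)) (Fin.tail i)
    simpa using this

theorem toField_eq_tensorEval {q : ℕ} (a : SymAlt q) (z : Fin 4 → ℂ) (k : Fin q → Fin 4) :
    toField a z k = tensorEval (fun i => a.1 i k) z := rfl

theorem SymAlt_isSymm {q : ℕ} (a : SymAlt q) (k : Fin q → Fin 4) : IsSymm fun i => a.1 i k := by
  intro σ i
  have := a.2 σ 1 i k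
  simpa using this

theorem SymAlt_isAntisymm {q : ℕ} (a : SymAlt q) (i : Fin q → Fin 4) :
    IsAntisymm fun k => a.1 i k := by
  intro τ k
  have := a.2 1 τ i k
  simpa using this

theorem toField_isAntisymm {q : ℕ} (a : SymAlt q) (z : Fin 4 → ℂ) : IsAntisymm (toField a z) := by
  intro τ k
  simp only [toField, Finset.mul_sum]
  refine Finset.sum_congr rfl fun i _ => ?_
  have := SymAlt_isAntisymm a i τ k
  simp only at this
  rw [this, mul_assoc]

theorem toField_injective {q : ℕ} {a b : SymAlt q} (h : ∀ z k, toField a z k = toField b z k) :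
    a = b := by
  apply Subtype.ext
  funext i k
  have hs : IsSymm ((fun i => a.1 i k) - fun i => b.1 i k) := by
    intro σ i
    have h1 := SymAlt_isSymm a k σ i
    have h2 := SymAlt_isSymm b k σ i
    simp only at h1 h2
    simp only [Pi.sub_apply, h1, h2]
  have := hs.eq_zero_of_tensorEval fun z => by
    rw [tensorEval_sub, sub_eq_zero]
    exact h z k
  exact sub_eq_zero.1 (congrFun this i)

theorem toField_smul {q : ℕ} (a : SymAlt q) (r : ℂ) (z : Fin 4 → ℂ) :
    toField a (r • z) = r ^ q • toField a z := by
  funext k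
  exact tensorEval_smul _ r z

/-- The coefficient arrays of the `q`-vector field belonging to an arbitrary tensor. -/
theorem toField_symAltProj {q : ℕ} (t : GlTensor q) (z : Fin 4 → ℂ) :
    toField (symAltProj q t) z = alternate fun k => tensorEval (fun i => t i k) z := by
  funext k
  have hq : (Nat.factorial q : ℂ) ≠ 0 := Nat.cast_ne_zero.2 (Nat.factorial_ne_zero q)
  -- Permuting the upper indices is invisible after evaluation, since the coordinates commute. The
  -- sum over σ therefore contributes q!, cancelling one of the two factorials.
  have h1 : ∀ (σ τ : Equiv.Perm (Fin q)),
      ∑ i : Fin q → Fin 4, t (i ∘ σ) (k ∘ τ) * ∏ m, z (i m) =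
        tensorEval (fun i => t i (k ∘ τ)) z := by
    intro σ τ
    unfold tensorEval
    refine Fintype.sum_equiv (Equiv.arrowCongr σ.symm (Equiv.refl _)) _ _ fun i => ?_
    congr 1
    exact (Fintype.prod_equiv σ _ _ fun m => rfl).symm
  have h2 : toField (symAltProj q t) z k = ((Nat.factorial q : ℂ) ^ 2)⁻¹ *
      ∑ σ : Equiv.Perm (Fin q), ∑ τ : Equiv.Perm (Fin q), ((Equiv.Perm.sign τ : ℤ) : ℂ) *
        ∑ i : Fin q → Fin 4, t (i ∘ σ) (k ∘ τ) * ∏ m, z (i m) := by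
    simp only [toField, symAltProj, LinearMap.coe_mk, AddHom.coe_mk, symAltCoeff, Finset.mul_sum,
      Finset.sum_mul]
    rw [Finset.sum_comm]
    refine Finset.sum_congr rfl fun σ _ => ?_
    rw [Finset.sum_comm]
    refine Finset.sum_congr rfl fun τ _ => Finset.sum_congr rfl fun i _ => by ring
  rw [h2]
  simp only [h1, alternate, Finset.sum_const, Finset.card_univ, Fintype.card_perm,
    Fintype.card_fin, nsmul_eq_mul]
  field_simp

/-! ### Antisymmetrization and induced maps -/

section
variable {ι κ μ : Type} {q : ℕ}

theorem sign_mul_self (τ : Equiv.Perm (Fin q)) :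
    ((Equiv.Perm.sign τ : ℤ) : ℂ) * ((Equiv.Perm.sign τ : ℤ) : ℂ) = 1 := by
  rw [← Int.cast_mul, ← Units.val_mul, Int.units_mul_self]
  simp

theorem alternate_comp_perm (t : (Fin q → ι) → ℂ) (σ : Equiv.Perm (Fin q)) :
    alternate (fun k => t (k ∘ σ)) = ((Equiv.Perm.sign σ : ℤ) : ℂ) • alternate t := by
  funext k
  simp only [alternate, Pi.smul_apply, smul_eq_mul]
  rw [mul_left_comm]
  congr 1
  rw [Finset.mul_sum]
  refine Fintype.sum_equiv (Equiv.mulRight σ) _ _ fun τ => ?_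
  simp only [Equiv.coe_mulRight, Equiv.Perm.sign_mul, Units.val_mul, Int.cast_mul,
    Equiv.Perm.coe_mul, Function.comp_assoc]
  linear_combination (-((Equiv.Perm.sign τ : ℤ) : ℂ) * t (k ∘ (τ ∘ σ))) * sign_mul_self σ

theorem alternate_isAntisymm (t : (Fin q → ι) → ℂ) : IsAntisymm (alternate t) := by
  intro σ k
  simp only [alternate]
  rw [mul_left_comm]
  congr 1
  rw [Finset.mul_sum]
  refine Fintype.sum_equiv (Equiv.mulLeft σ) _ _ fun τ => ?_
  simp only [Equiv.coe_mulLeft, Equiv.Perm.sign_mul, Units.val_mul, Int.cast_mul,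
    Equiv.Perm.coe_mul, Function.comp_assoc]
  linear_combination (-((Equiv.Perm.sign τ : ℤ) : ℂ) * t (k ∘ (σ ∘ τ))) * sign_mul_self σ

theorem IsAntisymm.alternate_eq {t : (Fin q → ι) → ℂ} (ht : IsAntisymm t) : alternate t = t := by
  funext k
  have hq : (Nat.factorial q : ℂ) ≠ 0 := Nat.cast_ne_zero.2 (Nat.factorial_ne_zero q)
  simp only [alternate]
  simp only [ht _ k, ← mul_assoc, sign_mul_self]
  simp [Fintype.card_perm, hq]

theorem alternate_add (s t : (Fin q → ι) → ℂ) : alternate (s + t) = alternate s + alternate t := by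
  funext k
  simp [alternate, mul_add, Finset.sum_add_distrib]

theorem alternate_smul (c : ℂ) (t : (Fin q → ι) → ℂ) : alternate (c • t) = c • alternate t := by
  funext k
  simp only [alternate, Pi.smul_apply, smul_eq_mul, Finset.mul_sum]
  exact Finset.sum_congr rfl fun i _ => by ring

variable [Fintype ι] [DecidableEq ι]

theorem pushMultivector_alternate [Fintype κ] (L : (ι → ℂ) →L[ℂ] (κ → ℂ)) (t : (Fin q → ι) → ℂ) :
    pushMultivector L (alternate t) = alternate (pushMultivector L t) := by
  funext k
  have h : ∀ τ : Equiv.Perm (Fin q), ∑ i : Fin q → ι,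
      (∏ m, L (Pi.single (i m) 1) (k m)) * t (i ∘ τ) = pushMultivector L t (k ∘ τ) := by
    intro τ
    unfold pushMultivector
    refine Fintype.sum_equiv (Equiv.arrowCongr τ.symm (Equiv.refl _)) _ _ fun i => ?_
    congr 1
    exact (Fintype.prod_equiv τ _ _ fun m => rfl).symm
  simp only [alternate, ← h]
  rw [pushMultivector]
  simp only [alternate, Finset.mul_sum]
  rw [Finset.sum_comm]
  refine Finset.sum_congr rfl fun τ _ => Finset.sum_congr rfl fun i _ => by ring

theorem IsAntisymm.pushMultivector {t : (Fin q → ι) → ℂ} (ht : IsAntisymm t)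
    [Fintype κ] (L : (ι → ℂ) →L[ℂ] (κ → ℂ)) : IsAntisymm (pushMultivector L t) := by
  rw [← ht.alternate_eq, pushMultivector_alternate]
  exact alternate_isAntisymm _

theorem apply_eq_sum_single (L : (ι → ℂ) →L[ℂ] (κ → ℂ)) (v : ι → ℂ) (k : κ) :
    L v k = ∑ i, L (Pi.single i 1) k * v i := by
  conv_lhs => rw [pi_eq_sum_univ' v]
  simp [mul_comm]

theorem pushMultivector_prod [Fintype κ] (L : (ι → ℂ) →L[ℂ] (κ → ℂ)) (v : Fin q → ι → ℂ) :
    pushMultivector L (fun i => ∏ m, v m (i m)) = fun k => ∏ m, L (v m) (k m) := by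
  funext k
  simp only [apply_eq_sum_single L (v _), pushMultivector]
  rw [Finset.prod_univ_sum]
  simp [Finset.prod_mul_distrib]

theorem pushMultivector_comp [Fintype κ] [DecidableEq κ] [Fintype μ] (L : (ι → ℂ) →L[ℂ] (κ → ℂ)) (M : (κ → ℂ) →L[ℂ] (μ → ℂ))
    (t : (Fin q → ι) → ℂ) :
    pushMultivector M (pushMultivector L t) = pushMultivector (M.comp L) t := by
  funext k
  simp only [pushMultivector, ContinuousLinearMap.comp_apply, Finset.mul_sum]
  rw [Finset.sum_comm]
  refine Finset.sum_congr rfl fun i _ => ?_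
  have h : ∀ m, M (L (Pi.single (i m) 1)) (k m) =
      ∑ j, M (Pi.single j 1) (k m) * L (Pi.single (i m) 1) j := fun m => by
    conv_lhs => rw [pi_eq_sum_univ' (L (Pi.single (i m) 1))]
    simp [mul_comm]
  simp only [h]
  rw [Finset.prod_univ_sum, Finset.sum_mul]
  simp only [Finset.prod_mul_distrib, Fintype.piFinset_univ, mul_assoc]

theorem pushMultivector_smul_map [Fintype κ] (L : (ι → ℂ) →L[ℂ] (κ → ℂ)) (c : ℂ) (t : (Fin q → ι) → ℂ) :
    pushMultivector (c • L) t = c ^ q • pushMultivector L t := by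
  funext k
  simp only [pushMultivector, Pi.smul_apply, _root_.smul_apply, smul_eq_mul,
    Finset.prod_mul_distrib, Finset.prod_const, Finset.card_univ, Fintype.card_fin, Finset.mul_sum,
    mul_assoc]

end

/-! ### The differential of the projection and the wedge product with the Euler field -/

theorem hasFDerivAt_affineCoord (r : Fin 4) {z : Fin 4 → ℂ} (hz : z r ≠ 0) :
    ∃ L : (Fin 4 → ℂ) →L[ℂ] (Idx r → ℂ), HasFDerivAt (affineCoord r) L z ∧
      ∀ v k, L v k = v k / z r - z k * v r / z r ^ 2 := by
  have hp : ∀ j : Fin 4, HasFDerivAt (fun y : Fin 4 → ℂ => y j)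
      (ContinuousLinearMap.proj (R := ℂ) (φ := fun _ : Fin 4 => ℂ) j) z :=
    fun j => hasFDerivAt_apply j z
  refine ⟨_, hasFDerivAt_pi.2 fun k : Idx r => (hp k).fun_mul
    ((hasDerivAt_inv hz).comp_hasFDerivAt z (hp r)), fun v k => ?_⟩
  simp
  field_simp
  ring

theorem differentiableAt_affineCoord (r : Fin 4) {z : Fin 4 → ℂ} (hz : z r ≠ 0) :
    DifferentiableAt ℂ (affineCoord r) z := by
  obtain ⟨L, hL, _⟩ := hasFDerivAt_affineCoord r hz
  exact hL.differentiableAt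

theorem fderiv_affineCoord (r : Fin 4) {z : Fin 4 → ℂ} (hz : z r ≠ 0) (v : Fin 4 → ℂ)
    (k : Idx r) :
    fderiv ℂ (affineCoord r) z v k = v k / z r - z k * v r / z r ^ 2 := by
  obtain ⟨L, hL, h⟩ := hasFDerivAt_affineCoord r hz
  rw [hL.fderiv, h]

theorem fderiv_affineCoord_self (r : Fin 4) {z : Fin 4 → ℂ} (hz : z r ≠ 0) :
    fderiv ℂ (affineCoord r) z z = 0 := by
  funext k
  rw [fderiv_affineCoord r hz]
  simp
  field_simp
  simp

theorem fderiv_affineCoord_smul (r : Fin 4) {z : Fin 4 → ℂ} (hz : z r ≠ 0) {c : ℂ} (hc : c ≠ 0) :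
    fderiv ℂ (affineCoord r) (c • z) = c⁻¹ • fderiv ℂ (affineCoord r) z := by
  ext v k
  have h : (c • z) r ≠ 0 := by simp [hc, hz]
  simp only [_root_.smul_apply, Pi.smul_apply, smul_eq_mul]
  rw [fderiv_affineCoord r hz, fderiv_affineCoord r h]
  simp only [Pi.smul_apply, smul_eq_mul]
  field_simp

/-- The coefficients of `z ∧ t`, up to a constant factor. -/
def eulerWedge {q : ℕ} (z : Fin 4 → ℂ) (t : (Fin q → Fin 4) → ℂ) : (Fin (q + 1) → Fin 4) → ℂ :=
  fun k => ∑ m : Fin (q + 1), (-1) ^ (m : ℕ) * (z (k m) * t fun l => k (m.succAbove l))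

theorem eulerWedge_two (z : Fin 4 → ℂ) (t : (Fin 2 → Fin 4) → ℂ) (a b c : Fin 4) :
    eulerWedge z t ![a, b, c] = z a * t ![b, c] - z b * t ![a, c] + z c * t ![a, b] := by
  have h0 : (fun l => ![a, b, c] ((0 : Fin 3).succAbove l)) = ![b, c] := by
    funext l; fin_cases l <;> rfl
  have h1 : (fun l => ![a, b, c] ((1 : Fin 3).succAbove l)) = ![a, c] := by
    funext l; fin_cases l <;> rfl
  have h2 : (fun l => ![a, b, c] ((2 : Fin 3).succAbove l)) = ![a, b] := by
    funext l; fin_cases l <;> rfl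
  refine (Fin.sum_univ_three _).trans ?_
  simp only [h0, h1, h2]
  simp
  ring

theorem eulerWedge_three (z : Fin 4 → ℂ) (t : (Fin 3 → Fin 4) → ℂ) (a b c d : Fin 4) :
    eulerWedge z t ![a, b, c, d] =
      z a * t ![b, c, d] - z b * t ![a, c, d] + z c * t ![a, b, d] - z d * t ![a, b, c] := by
  have h0 : (fun l => ![a, b, c, d] ((0 : Fin 4).succAbove l)) = ![b, c, d] := by
    funext l; fin_cases l <;> rfl
  have h1 : (fun l => ![a, b, c, d] ((1 : Fin 4).succAbove l)) = ![a, c, d] := by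
    funext l; fin_cases l <;> rfl
  have h2 : (fun l => ![a, b, c, d] ((2 : Fin 4).succAbove l)) = ![a, b, d] := by
    funext l; fin_cases l <;> rfl
  have h3 : (fun l => ![a, b, c, d] ((3 : Fin 4).succAbove l)) = ![a, b, c] := by
    funext l; fin_cases l <;> rfl
  refine (Fin.sum_univ_four _).trans ?_
  simp only [h0, h1, h2, h3]
  simp
  ring

/-! ### Bivectors and trivectors in explicit indices, and the kernel of dπ at a point -/

theorem IsAntisymm.swap_two {ι : Type} {t : (Fin 2 → ι) → ℂ} (ht : IsAntisymm t) (a b : ι) :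
    t ![b, a] = -t ![a, b] := by
  have h := ht (Equiv.swap 0 1) ![a, b]
  have e : (![a, b] ∘ (Equiv.swap 0 1 : Equiv.Perm (Fin 2))) = ![b, a] := by
    funext l; fin_cases l <;> simp
  rw [e] at h
  simpa using h

theorem IsAntisymm.swap_three_left {ι : Type} {t : (Fin 3 → ι) → ℂ} (ht : IsAntisymm t)
    (a b c : ι) : t ![b, a, c] = -t ![a, b, c] := by
  have h := ht (Equiv.swap 0 1) ![a, b, c]
  have e : (![a, b, c] ∘ (Equiv.swap 0 1 : Equiv.Perm (Fin 3))) = ![b, a, c] := by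
    funext l
    fin_cases l
    · simp
    · simp
    · simp [Equiv.swap_apply_of_ne_of_ne]
  rw [e] at h
  simpa using h

theorem IsAntisymm.swap_three_right {ι : Type} {t : (Fin 3 → ι) → ℂ} (ht : IsAntisymm t)
    (a b c : ι) : t ![a, c, b] = -t ![a, b, c] := by
  have h := ht (Equiv.swap 1 2) ![a, b, c]
  have e : (![a, b, c] ∘ (Equiv.swap 1 2 : Equiv.Perm (Fin 3))) = ![a, c, b] := by
    funext l
    fin_cases l
    · simp [Equiv.swap_apply_of_ne_of_ne]
    · simp
    · simp
  rw [e] at h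
  simpa using h

theorem sum_fin_two_fun {ι : Type} [Fintype ι] (f : (Fin 2 → ι) → ℂ) :
    ∑ i, f i = ∑ a, ∑ b, f ![a, b] := by
  rw [← (finTwoArrowEquiv ι).symm.sum_comp, Fintype.sum_prod_type]
  rfl

theorem sum_fin_three_fun {ι : Type} [Fintype ι] (f : (Fin 3 → ι) → ℂ) :
    ∑ i, f i = ∑ a, ∑ b, ∑ c, f ![a, b, c] := by
  rw [← (Fin.consEquiv (fun _ : Fin 3 => ι)).sum_comp, Fintype.sum_prod_type]
  refine Finset.sum_congr rfl fun a _ => ?_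
  rw [sum_fin_two_fun]
  rfl

theorem sum_fderiv_affineCoord_single (r : Fin 4) {z : Fin 4 → ℂ} (hz : z r ≠ 0) (k : Idx r)
    (f : Fin 4 → ℂ) :
    ∑ a, fderiv ℂ (affineCoord r) z (Pi.single a 1) k * f a =
      f k / z r - z k / z r ^ 2 * f r := by
  simp only [fderiv_affineCoord r hz, Pi.single_apply, sub_mul, Finset.sum_sub_distrib, ite_div,
    mul_ite, ite_mul, zero_div, zero_mul, mul_zero, Finset.sum_ite_eq, Finset.mem_univ, if_true]
  ring

/-- Each slot is transformed by v ↦ v_k / z_r - z_k v_r / z_r². Expanding, the term with two indices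
r vanishes by antisymmetry, and the three surviving terms are those of z ∧ t. -/
theorem pushMultivector_affineCoord_two (r : Fin 4) {z : Fin 4 → ℂ} (hz : z r ≠ 0)
    {t : (Fin 2 → Fin 4) → ℂ} (ht : IsAntisymm t) (k : Fin 2 → Idx r) :
    pushMultivector (fderiv ℂ (affineCoord r) z) t k =
      (z r ^ 3)⁻¹ * eulerWedge z t ![r, k 0, k 1] := by
  have h : pushMultivector (fderiv ℂ (affineCoord r) z) t k =
      ∑ a, fderiv ℂ (affineCoord r) z (Pi.single a 1) (k 0) *
        ∑ b, fderiv ℂ (affineCoord r) z (Pi.single b 1) (k 1) * t ![a, b] := by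
    rw [pushMultivector, sum_fin_two_fun]
    simp only [Fin.prod_univ_two, Finset.mul_sum, mul_assoc]
    rfl
  have hrr : t ![r, r] = 0 := self_eq_neg.1 (ht.swap_two r r)
  rw [h]
  simp only [sum_fderiv_affineCoord_single r hz, eulerWedge_two, hrr]
  rw [ht.swap_two r (k 0)]
  field_simp
  ring

theorem pushMultivector_affineCoord_three (r : Fin 4) {z : Fin 4 → ℂ} (hz : z r ≠ 0)
    {t : (Fin 3 → Fin 4) → ℂ} (ht : IsAntisymm t) (k : Fin 3 → Idx r) :
    pushMultivector (fderiv ℂ (affineCoord r) z) t k =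
      (z r ^ 4)⁻¹ * eulerWedge z t ![r, k 0, k 1, k 2] := by
  have h : pushMultivector (fderiv ℂ (affineCoord r) z) t k =
      ∑ a, fderiv ℂ (affineCoord r) z (Pi.single a 1) (k 0) *
        ∑ b, fderiv ℂ (affineCoord r) z (Pi.single b 1) (k 1) *
          ∑ c, fderiv ℂ (affineCoord r) z (Pi.single c 1) (k 2) * t ![a, b, c] := by
    rw [pushMultivector, sum_fin_three_fun]
    simp only [Fin.prod_univ_three, Finset.mul_sum, mul_assoc]
    rfl
  have h1 : ∀ a, t ![r, r, a] = 0 := fun a => self_eq_neg.1 (ht.swap_three_left r r a)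
  have h2 : ∀ a, t ![a, r, r] = 0 := fun a => self_eq_neg.1 (ht.swap_three_right a r r)
  have h3 : ∀ a, t ![r, a, r] = 0 := fun a => by
    rw [ht.swap_three_right, h1, neg_zero]
  rw [h]
  simp only [sum_fderiv_affineCoord_single r hz, eulerWedge_three, h1, h2, h3]
  rw [ht.swap_three_left r (k 0) (k 2), ht.swap_three_right (k 0) r (k 1),
    ht.swap_three_left r (k 0) (k 1)]
  field_simp
  ring

/-- Bivectors in the kernel of `dπ` are annihilated by the wedge product with the Euler field. -/
theorem eulerWedge_eq_zero_of_push_two (r : Fin 4) {z : Fin 4 → ℂ} (hz : z r ≠ 0)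
    {t : (Fin 2 → Fin 4) → ℂ} (ht : IsAntisymm t)
    (h : pushMultivector (fderiv ℂ (affineCoord r) z) t = 0) (a b c : Fin 4) :
    eulerWedge z t ![a, b, c] = 0 := by
  have key : ∀ a b, eulerWedge z t ![r, a, b] = 0 := by
    intro a b
    by_cases ha : a = r
    · subst ha
      rw [eulerWedge_two, self_eq_neg.1 (ht.swap_two a a)]
      ring
    by_cases hb : b = r
    · subst hb
      rw [eulerWedge_two, ht.swap_two b a, self_eq_neg.1 (ht.swap_two b b)]
      ring
    have h' := congrFun h ![⟨a, ha⟩, ⟨b, hb⟩]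
    rw [pushMultivector_affineCoord_two r hz ht] at h'
    simpa [hz] using h'
  have h1 := key b c
  have h2 := key a c
  have h3 := key a b
  apply (mul_eq_zero.1 (?_ : z r * _ = 0)).resolve_left hz
  rw [eulerWedge_two] at *
  -- This is the (r, a, b, c) component of z ∧ (z ∧ t) = 0.
  linear_combination z a * h1 - z b * h2 + z c * h3

/-- Trivectors in the kernel of `dπ` are annihilated by the wedge product with the Euler field. -/
theorem eulerWedge_eq_zero_of_push_three (r : Fin 4) {z : Fin 4 → ℂ} (hz : z r ≠ 0)
    {t : (Fin 3 → Fin 4) → ℂ} (ht : IsAntisymm t)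
    (h : pushMultivector (fderiv ℂ (affineCoord r) z) t = 0) (a b c d : Fin 4) :
    eulerWedge z t ![a, b, c, d] = 0 := by
  have hl : ∀ a b, t ![a, a, b] = 0 := fun a b => self_eq_neg.1 (ht.swap_three_left a a b)
  have hr : ∀ a b, t ![b, a, a] = 0 := fun a b => self_eq_neg.1 (ht.swap_three_right b a a)
  have hm : ∀ a b, t ![a, b, a] = 0 := fun a b => by rw [ht.swap_three_right, hl, neg_zero]
  have key : ∀ a b c, eulerWedge z t ![r, a, b, c] = 0 := by
    intro a b c
    by_cases ha : a = r
    · subst ha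
      rw [eulerWedge_three, hl, hl]
      ring
    by_cases hb : b = r
    · subst hb
      rw [eulerWedge_three, hl, hm, ht.swap_three_left b a c]
      ring
    by_cases hc : c = r
    · subst hc
      rw [eulerWedge_three, hm, hm, ht.swap_three_right a c b, ht.swap_three_left c a b]
      ring
    have h' := congrFun h ![⟨a, ha⟩, ⟨b, hb⟩, ⟨c, hc⟩]
    rw [pushMultivector_affineCoord_three r hz ht] at h'
    simpa [hz] using h'
  have h1 := key b c d
  have h2 := key a c d
  have h3 := key a b d
  have h4 := key a b c
  apply (mul_eq_zero.1 (?_ : z r * _ = 0)).resolve_left hz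
  rw [eulerWedge_three] at *
  linear_combination z a * h1 - z b * h2 + z c * h3 - z d * h4

/-! ### The `q`-vector on `ℂP³` belonging to an invariant `q`-vector on `ℂ⁴` -/

@[simp] theorem affineVec_self (r : Fin 4) (ζ : Idx r → ℂ) : affineVec r ζ r = 1 := by
  simp [affineVec]

theorem affineVec_apply (r : Fin 4) (ζ : Idx r → ℂ) (k : Idx r) : affineVec r ζ k = ζ k := by
  simp [affineVec, k.2]

theorem affineVec_affineCoord (r : Fin 4) {z : Fin 4 → ℂ} (hz : z r ≠ 0) :
    affineVec r (affineCoord r z) = (z r)⁻¹ • z := by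
  funext i
  by_cases h : i = r
  · subst h
    simp [hz]
  · simp [affineVec, h, affineCoord, div_eq_inv_mul]

theorem affineCoord_affineVec (r : Fin 4) (ζ : Idx r → ℂ) :
    affineCoord r (affineVec r ζ) = ζ := by
  funext k
  simp [affineCoord, affineVec_apply]

theorem chart_mk (r : Fin 4) (z : Fin 4 → ℂ) (hz : z ≠ 0) :
    chart r (Projectivization.mk ℂ z hz) = affineCoord r z := rfl

theorem transition_eq (r s : Fin 4) :
    transition r s = fun ζ => affineCoord s (affineVec r ζ) := rfl

theorem differentiable_affineVec (r : Fin 4) : Differentiable ℂ (affineVec r) := by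
  rw [differentiable_pi]
  intro i
  unfold affineVec
  split_ifs
  · fun_prop
  · fun_prop

theorem transition_affineCoord (r s : Fin 4) {z : Fin 4 → ℂ} (hz : z r ≠ 0) :
    transition r s (affineCoord r z) = affineCoord s z := by
  rw [transition_eq]
  simp only [affineVec_affineCoord r hz]
  exact affineCoord_smul s _ (inv_ne_zero hz) z

theorem isOpen_apply_ne_zero (r : Fin 4) : IsOpen {z : Fin 4 → ℂ | z r ≠ 0} :=
  isOpen_ne_fun (continuous_apply r) continuous_const

/-- Chain rule; the change of charts relates the two coordinate maps only where z_r ≠ 0, so the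
identity is used on a neighbourhood of z. -/
theorem fderiv_affineCoord_eq_comp (r s : Fin 4) {z : Fin 4 → ℂ} (hr : z r ≠ 0) (hs : z s ≠ 0) :
    fderiv ℂ (affineCoord s) z =
      (fderiv ℂ (transition r s) (affineCoord r z)).comp (fderiv ℂ (affineCoord r) z) := by
  have hd : DifferentiableAt ℂ (transition r s) (affineCoord r z) := by
    rw [transition_eq]
    refine DifferentiableAt.comp _ (differentiableAt_affineCoord s ?_) (differentiable_affineVec r _)
    rw [affineVec_affineCoord r hr]
    simp [hr, hs]
  rw [← fderiv_comp z hd (differentiableAt_affineCoord r hr)]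
  refine Filter.EventuallyEq.fderiv_eq ?_
  filter_upwards [(isOpen_apply_ne_zero r).mem_nhds hr] with y hy
  exact (transition_affineCoord r s hy).symm

/-- The coefficients of `dπ(w_a)` in the affine charts. -/
noncomputable def pushField {q : ℕ} (a : SymAlt q) (r : Fin 4) (ζ : Idx r → ℂ) :
    (Fin q → Idx r) → ℂ :=
  pushMultivector (fderiv ℂ (affineCoord r) (affineVec r ζ)) (toField a (affineVec r ζ))

/-- The coefficients of w_a have degree q and the map induced by dπ on q-vectors has degree -q, so
the image is constant along the fibre and may be computed at the normalized representative. -/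
theorem push_toField_eq_pushField {q : ℕ} (a : SymAlt q) (r : Fin 4) {z : Fin 4 → ℂ}
    (hz : z r ≠ 0) :
    pushMultivector (fderiv ℂ (affineCoord r) z) (toField a z) =
      pushField a r (affineCoord r z) := by
  rw [pushField, affineVec_affineCoord r hz, fderiv_affineCoord_smul r hz (inv_ne_zero hz),
    toField_smul, pushMultivector_smul, pushMultivector_smul_map, smul_smul, inv_inv, ← mul_pow,
    inv_mul_cancel₀ hz, one_pow, one_smul]

theorem differentiable_pushField {q : ℕ} (a : SymAlt q) (r : Fin 4) (k : Fin q → Idx r) :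
    Differentiable ℂ fun ζ => pushField a r ζ k := by
  have hL : ∀ (ζ : Idx r → ℂ) (v : Fin 4 → ℂ) (l : Idx r),
      fderiv ℂ (affineCoord r) (affineVec r ζ) v l = v l - ζ l * v r := fun ζ v l => by
    rw [fderiv_affineCoord r (by simp), affineVec_self, affineVec_apply]
    simp
  have ht : ∀ i : Fin q → Fin 4, Differentiable ℂ fun ζ : Idx r → ℂ =>
      toField a (affineVec r ζ) i := fun i =>
    (differentiable_tensorEval fun j => a.1 j i).comp (differentiable_affineVec r)
  simp only [pushField, pushMultivector, hL]
  fun_prop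

theorem toField_add {q : ℕ} (a b : SymAlt q) (z : Fin 4 → ℂ) :
    toField (a + b) z = toField a z + toField b z := by
  funext k
  simp [toField, add_mul, Finset.sum_add_distrib]

theorem toField_const_smul {q : ℕ} (c : ℂ) (a : SymAlt q) (z : Fin 4 → ℂ) :
    toField (c • a) z = c • toField a z := by
  funext k
  simp [toField, mul_assoc, Finset.mul_sum]

/-- The linear map `a ↦ dπ(w_a)`. -/
noncomputable def pushforwardMap (q : ℕ) : SymAlt q →ₗ[ℂ] HolMultivector q where
  toFun a := ⟨pushField a, fun r ζ => (toField_isAntisymm a _).pushMultivector _,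
    differentiable_pushField a, by
      rintro r s p ⟨hr, hs⟩
      have hp : chart r p = affineCoord r p.rep := by
        conv_lhs => rw [← p.mk_rep]
        exact chart_mk r p.rep p.rep_nonzero
      have hp' : chart s p = affineCoord s p.rep := by
        conv_lhs => rw [← p.mk_rep]
        exact chart_mk s p.rep p.rep_nonzero
      rw [hp, hp', ← push_toField_eq_pushField a r hr, ← push_toField_eq_pushField a s hs,
        pushMultivector_comp, fderiv_affineCoord_eq_comp r s hr hs]⟩
  map_add' a b := by
    apply Subtype.ext
    funext r ζ
    simp only [Submodule.coe_add, Pi.add_apply, pushField, toField_add, pushMultivector_add]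
  map_smul' c a := by
    apply Subtype.ext
    funext r ζ
    simp only [Submodule.coe_smul, Pi.smul_apply, pushField, toField_const_smul,
      pushMultivector_smul, RingHom.id_apply]

theorem pushforwardMap_coe {q : ℕ} (a : SymAlt q) : (pushforwardMap q a).1 = pushField a := rfl

theorem isPushforward_pushforwardMap {q : ℕ} (a : SymAlt q) :
    IsPushforward (toField a) (pushforwardMap q a) := by
  intro r z hz hr
  rw [chart_mk, pushforwardMap_coe, push_toField_eq_pushField a r hr]

theorem push_toField_of_mem_ker {q : ℕ} {a : SymAlt q} (h : pushforwardMap q a = 0) (r : Fin 4)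
    {z : Fin 4 → ℂ} (hz : z r ≠ 0) :
    pushMultivector (fderiv ℂ (affineCoord r) z) (toField a z) = 0 := by
  rw [push_toField_eq_pushField a r hz, ← pushforwardMap_coe, h]
  rfl

theorem pushforwardMap_eq_zero {q : ℕ} {a : SymAlt q}
    (h : ∀ r z, z r ≠ 0 → pushMultivector (fderiv ℂ (affineCoord r) z) (toField a z) = 0) :
    pushforwardMap q a = 0 := by
  apply Subtype.ext
  funext r ζ
  exact h r (affineVec r ζ) (by simp)

theorem tensorEval_pureTensor {q : ℕ} (B : Fin q → Matrix (Fin 4) (Fin 4) ℂ) (z : Fin 4 → ℂ)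
    (k : Fin q → Fin 4) :
    tensorEval (fun i => pureTensor B i k) z = ∏ m, Matrix.vecMul z (B m) (k m) := by
  simp only [Matrix.vecMul, dotProduct]
  rw [Finset.prod_univ_sum]
  simp only [tensorEval, pureTensor, Fintype.piFinset_univ, ← Finset.prod_mul_distrib, mul_comm]

/-- A decomposable tensor evaluates to a wedge of linear vector fields. Its last factor is a
multiple of the Euler field, which is tangent to the fibres of π. -/
theorem eulerPart_le_ker (n : ℕ) : eulerPart n ≤ LinearMap.ker (pushforwardMap (n + 1)) := by
  rw [eulerPart, Submodule.map_le_iff_le_comap, slTensorE, Submodule.span_le]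
  rintro _ ⟨B, -, hB, rfl⟩
  obtain ⟨c, hc⟩ := Submodule.mem_span_singleton.1 hB
  refine pushforwardMap_eq_zero fun r z hz => ?_
  have hlast : Matrix.vecMul z (B (Fin.last n)) = c • z := by
    rw [← hc]
    simp [Matrix.vecMul_smul]
  rw [toField_symAltProj, pushMultivector_alternate]
  simp only [tensorEval_pureTensor]
  rw [pushMultivector_prod]
  have h0 : (fun k : Fin (n + 1) → Idx r => ∏ m, fderiv ℂ (affineCoord r) z
      (Matrix.vecMul z (B m)) (k m)) = 0 := by
    funext k
    refine Finset.prod_eq_zero (Finset.mem_univ (Fin.last n)) ?_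
    rw [hlast, map_smul, fderiv_affineCoord_self r hz]
    simp
  rw [h0]
  funext k
  simp [alternate]

/-! ### The Schouten bracket -/

section
variable {ι : Type}

theorem sum_comm_three {α β γ δ : Type} [Fintype α] [Fintype β] [Fintype γ] [Fintype δ]
    (F : α → β → γ → δ → ℂ) :
    ∑ a, ∑ b, ∑ c, ∑ d, F a b c d = ∑ d, ∑ a, ∑ b, ∑ c, F a b c d := by
  rw [Finset.sum_comm (s := (Finset.univ : Finset δ))]
  refine Finset.sum_congr rfl fun a _ => ?_
  rw [Finset.sum_comm (s := (Finset.univ : Finset δ))]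
  refine Finset.sum_congr rfl fun b _ => ?_
  rw [Finset.sum_comm]

theorem alternate_swap_zero_one (t : ι → ι → ι → ℂ) :
    alternate (fun k : Fin 3 → ι => t (k 1) (k 0) (k 2)) =
      -alternate fun k : Fin 3 → ι => t (k 0) (k 1) (k 2) := by
  have h := alternate_comp_perm (fun k : Fin 3 → ι => t (k 0) (k 1) (k 2)) (Equiv.swap 0 1)
  simpa [Equiv.swap_apply_of_ne_of_ne] using h

theorem alternate_swap_one_two (t : ι → ι → ι → ℂ) :
    alternate (fun k : Fin 3 → ι => t (k 0) (k 2) (k 1)) =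
      -alternate fun k : Fin 3 → ι => t (k 0) (k 1) (k 2) := by
  have h := alternate_comp_perm (fun k : Fin 3 → ι => t (k 0) (k 1) (k 2)) (Equiv.swap 1 2)
  simpa [Equiv.swap_apply_of_ne_of_ne] using h

theorem alternate_swap_zero_two (t : ι → ι → ι → ℂ) :
    alternate (fun k : Fin 3 → ι => t (k 2) (k 1) (k 0)) =
      -alternate fun k : Fin 3 → ι => t (k 0) (k 1) (k 2) := by
  have h := alternate_comp_perm (fun k : Fin 3 → ι => t (k 0) (k 1) (k 2)) (Equiv.swap 0 2)
  simpa [Equiv.swap_apply_of_ne_of_ne] using h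

theorem alternate_rotate (t : ι → ι → ι → ℂ) :
    alternate (fun k : Fin 3 → ι => t (k 2) (k 0) (k 1)) =
      alternate fun k : Fin 3 → ι => t (k 0) (k 1) (k 2) := by
  rw [alternate_swap_zero_two fun a b c => t a c b, alternate_swap_one_two t, neg_neg]

variable [Fintype ι] [DecidableEq ι]

/-- One half of the Schouten bracket, before antisymmetrization. -/
noncomputable def derivAlong (θ η : (ι → ℂ) → (Fin 2 → ι) → ℂ) (z : ι → ℂ) : (Fin 3 → ι) → ℂ :=
  fun k => ∑ i, θ z ![i, k 0] * partialDeriv i (fun y => η y ![k 1, k 2]) z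

/-- Antisymmetry doubles each of the two kinds of term, and the second kind differs from the mirror
image of the first by a cyclic, hence even, permutation of the indices. -/
theorem schouten_eq {θ η : (ι → ℂ) → (Fin 2 → ι) → ℂ} {z : ι → ℂ} (hθ : IsAntisymm (θ z))
    (hη : IsAntisymm (η z)) :
    schouten θ η z = (-2 : ℂ) • (alternate (derivAlong θ η z) + alternate (derivAlong η θ z)) := by
  have h := alternate_rotate fun a b c =>
    ∑ i, η z ![i, a] * partialDeriv i (fun y => θ y ![b, c]) z
  have h' : alternate (derivAlong η θ z) = alternate fun k : Fin 3 → ι =>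
      ∑ i, η z ![i, k 2] * partialDeriv i (fun y => θ y ![k 0, k 1]) z := h.symm
  rw [h', ← alternate_add, ← alternate_smul]
  simp only [schouten]
  congr 1
  funext k
  simp only [derivAlong, Pi.smul_apply, Pi.add_apply, smul_eq_mul, ← Finset.sum_add_distrib,
    Finset.mul_sum, ← Finset.sum_neg_distrib]
  refine Finset.sum_congr rfl fun i _ => ?_
  rw [hθ.swap_two i (k 0), hη.swap_two i (k 2)]
  ring

end

/-! #### The bracket of invariant bivectors -/

theorem tensorEval_one (c : (Fin 1 → Fin 4) → ℂ) (z : Fin 4 → ℂ) :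
    tensorEval c z = ∑ j, c ![j] * z j := by
  rw [tensorEval_succ]
  refine Finset.sum_congr rfl fun j _ => ?_
  rw [tensorEval_zero _ z ![], mul_comm]
  rfl

theorem toField_two (a : SymAlt 2) (z : Fin 4 → ℂ) (k : Fin 2 → Fin 4) :
    toField a z k = ∑ i, ∑ j, a.1 ![i, j] k * (z i * z j) := by
  rw [toField, sum_fin_two_fun]
  simp [Fin.prod_univ_two]

theorem partialDeriv_toField_two (a : SymAlt 2) (z : Fin 4 → ℂ) (m : Fin 4) (k : Fin 2 → Fin 4) :
    partialDeriv m (fun y => toField a y k) z = 2 * ∑ j, a.1 ![m, j] k * z j := by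
  have h := partialDeriv_tensorEval (SymAlt_isSymm a k) m z
  rw [tensorEval_one] at h
  refine h.trans ?_
  norm_num

theorem sum_contract (f : Fin 4 → Fin 4 → Fin 4 → ℂ) (g : Fin 4 → Fin 4 → ℂ) (z : Fin 4 → ℂ) :
    ∑ i, ∑ j, ∑ l, (∑ m, f i j m * g m l) * (z i * z j * z l) =
      ∑ m, (∑ i, ∑ j, f i j m * (z i * z j)) * ∑ l, g m l * z l := by
  simp only [Finset.sum_mul]
  simp only [Finset.mul_sum]
  rw [sum_comm_three]
  refine Finset.sum_congr rfl fun m _ => Finset.sum_congr rfl fun i _ =>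
    Finset.sum_congr rfl fun j _ => Finset.sum_congr rfl fun l _ => by ring

/-- Differentiating a quadratic coefficient gives twice a linear form, and summing over the
derivative index multiplies the matrices A_{jl} and A'_{j'l'}. The two halves of the bracket give
the two orders of multiplication. -/
theorem schouten_toField (a a' : SymAlt 2) (z : Fin 4 → ℂ) :
    schouten (toField a) (toField a') z = toField (Ftilde a a') z := by
  rw [schouten_eq (toField_isAntisymm a z) (toField_isAntisymm a' z)]
  have hF : Ftilde a a' = symAltProj 3 ((4 : ℂ) • bracketTensor a a') := rfl
  rw [hF, toField_symAltProj]
  -- The factor 4 leaves a 2 in front of each half, the other 2 being the degree of the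
  -- differentiated form. The index order (1, 0, 2) is odd and (2, 0, 1) is even, so
  -- antisymmetrization turns 2 and -2 into the common factor -2.
  have h1 : (fun k : Fin 3 → Fin 4 => tensorEval (fun i => ((4 : ℂ) • bracketTensor a a') i k) z) =
      (2 : ℂ) • (fun k : Fin 3 → Fin 4 => derivAlong (toField a) (toField a') z ![k 1, k 0, k 2]) +
      (-2 : ℂ) • fun k : Fin 3 → Fin 4 =>
        derivAlong (toField a') (toField a) z ![k 2, k 0, k 1] := by
    funext k
    have e1 := sum_contract (fun i j m => a.1 ![i, j] ![m, k 1])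
      (fun m l => a'.1 ![m, l] ![k 0, k 2]) z
    have e2 := sum_contract (fun i j m => a'.1 ![i, j] ![m, k 2])
      (fun m l => a.1 ![m, l] ![k 0, k 1]) z
    have d1 : derivAlong (toField a) (toField a') z ![k 1, k 0, k 2] =
        ∑ m, (∑ i, ∑ j, a.1 ![i, j] ![m, k 1] * (z i * z j)) *
          (2 * ∑ l, a'.1 ![m, l] ![k 0, k 2] * z l) := by
      simp only [derivAlong, partialDeriv_toField_two, toField_two a]
      rfl
    have d2 : derivAlong (toField a') (toField a) z ![k 2, k 0, k 1] =
        ∑ m, (∑ i, ∑ j, a'.1 ![i, j] ![m, k 2] * (z i * z j)) *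
          (2 * ∑ l, a.1 ![m, l] ![k 0, k 1] * z l) := by
      simp only [derivAlong, partialDeriv_toField_two, toField_two a']
      rfl
    have d3 : tensorEval (fun i => ((4 : ℂ) • bracketTensor a a') i k) z =
        4 * ∑ i, ∑ j, ∑ l, (∑ m, a.1 ![i, j] ![m, k 1] * a'.1 ![m, l] ![k 0, k 2]) *
          (z i * z j * z l) -
        4 * ∑ i, ∑ j, ∑ l, (∑ m, a'.1 ![i, j] ![m, k 2] * a.1 ![m, l] ![k 0, k 1]) *
          (z i * z j * z l) := by
      rw [tensorEval, sum_fin_three_fun, ← mul_sub, ← Finset.sum_sub_distrib, Finset.mul_sum]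
      refine Finset.sum_congr rfl fun i _ => ?_
      rw [Finset.sum_comm (f := fun j l => (∑ m, a'.1 ![i, j] ![m, k 2] *
        a.1 ![m, l] ![k 0, k 1]) * (z i * z j * z l)), ← Finset.sum_sub_distrib, Finset.mul_sum]
      refine Finset.sum_congr rfl fun j _ => ?_
      rw [← Finset.sum_sub_distrib, Finset.mul_sum]
      refine Finset.sum_congr rfl fun l _ => ?_
      simp only [Fin.prod_univ_three, Pi.smul_apply, smul_eq_mul, bracketTensor, Ring.lie_def,
        Matrix.sub_apply, Matrix.mul_apply, blockMatrix, Matrix.of_apply]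
      simp
      ring
    refine d3.trans ?_
    simp only [Pi.add_apply, Pi.smul_apply, smul_eq_mul]
    rw [d1, d2, e1, e2]
    simp only [mul_left_comm _ (2 : ℂ), ← Finset.mul_sum]
    ring
  rw [h1, alternate_add, alternate_smul, alternate_smul]
  have h2 := alternate_swap_zero_one fun a₁ b c =>
    derivAlong (toField a) (toField a') z ![a₁, b, c]
  have h3 := alternate_rotate fun a₁ b c =>
    derivAlong (toField a') (toField a) z ![a₁, b, c]
  have h4 : ∀ k : Fin 3 → Fin 4, ![k 0, k 1, k 2] = k := fun k => by
    funext i; fin_cases i <;> rfl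
  simp only [h4] at h2 h3
  rw [h2, h3]
  module

/-! #### Naturality -/

section
variable {ι κ : Type} [Fintype ι] [DecidableEq ι] [Fintype κ]
  {φ : (ι → ℂ) → (κ → ℂ)} {z : ι → ℂ}

/-- The entry of the Jacobian matrix of `φ`. -/
noncomputable def jacobian (φ : (ι → ℂ) → (κ → ℂ)) (k : κ) (i : ι) (y : ι → ℂ) : ℂ :=
  fderiv ℂ φ y (Pi.single i 1) k

theorem partialDeriv_comp [DecidableEq κ] {g : (κ → ℂ) → ℂ} (hg : DifferentiableAt ℂ g (φ z))
    (hφ : DifferentiableAt ℂ φ z) (i : ι) :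
    partialDeriv i (fun y => g (φ y)) z = ∑ m, jacobian φ m i z * partialDeriv m g (φ z) := by
  have h : fderiv ℂ (fun y => g (φ y)) z = (fderiv ℂ g (φ z)).comp (fderiv ℂ φ z) :=
    fderiv_comp z hg hφ
  rw [partialDeriv, h, ContinuousLinearMap.comp_apply]
  conv_lhs => rw [pi_eq_sum_univ' (fderiv ℂ φ z (Pi.single i 1))]
  simp [jacobian, partialDeriv]

theorem hasFDerivAt_jacobian (hφ : ContDiffAt ℂ 2 φ z) (k : κ) (a : ι) :
    ∃ L : (ι → ℂ) →L[ℂ] ℂ, HasFDerivAt (jacobian φ k a) L z ∧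
      ∀ v, L v = fderiv ℂ (fderiv ℂ φ) z v (Pi.single a 1) k := by
  have h : DifferentiableAt ℂ (fderiv ℂ φ) z :=
    (hφ.fderiv_right (m := 1) (by norm_num)).differentiableAt (by norm_num)
  exact ⟨_, hasFDerivAt_pi'.1 (h.hasFDerivAt.clm_apply
    (hasFDerivAt_const (Pi.single a (1 : ℂ) : ι → ℂ) z)) k, fun v => by simp⟩

theorem differentiableAt_jacobian (hφ : ContDiffAt ℂ 2 φ z) (k : κ) (a : ι) :
    DifferentiableAt ℂ (jacobian φ k a) z := by
  obtain ⟨L, hL, -⟩ := hasFDerivAt_jacobian hφ k a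
  exact hL.differentiableAt

theorem partialDeriv_jacobian_comm (hφ : ContDiffAt ℂ 2 φ z) (k : κ) (i a : ι) :
    partialDeriv i (jacobian φ k a) z = partialDeriv a (jacobian φ k i) z := by
  obtain ⟨L, hL, h⟩ := hasFDerivAt_jacobian hφ k a
  obtain ⟨M, hM, h'⟩ := hasFDerivAt_jacobian hφ k i
  rw [partialDeriv, partialDeriv, hL.fderiv, hM.fderiv, h, h']
  have hs := hφ.isSymmSndFDerivAt (by simp)
  rw [hs.eq]

theorem pushMultivector_two (θ : (Fin 2 → ι) → ℂ) (y : ι → ℂ) (k l : κ) :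
    pushMultivector (fderiv ℂ φ y) θ ![k, l] =
      ∑ a, ∑ b, jacobian φ k a y * jacobian φ l b y * θ ![a, b] := by
  rw [pushMultivector, sum_fin_two_fun]
  simp [Fin.prod_univ_two, jacobian]

/-- The terms with second derivatives of `φ` in the Schouten bracket. -/
noncomputable def secondOrderTerm (φ : (ι → ℂ) → (κ → ℂ)) (θ η : (Fin 2 → ι) → ℂ) (z : ι → ℂ)
    (k l m : κ) : ℂ :=
  ∑ i, ∑ a, (∑ c, jacobian φ k c z * θ ![i, c]) * partialDeriv i (jacobian φ l a) z *
    ∑ b, jacobian φ m b z * η ![a, b]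

/-- Symmetry of the second derivatives of φ: exchanging the bivectors amounts to exchanging the two
outer free indices. -/
theorem secondOrderTerm_comm (hφ : ContDiffAt ℂ 2 φ z) (θ η : (Fin 2 → ι) → ℂ) (k l m : κ) :
    secondOrderTerm φ η θ z k l m = secondOrderTerm φ θ η z m l k := by
  unfold secondOrderTerm
  rw [Finset.sum_comm]
  refine Finset.sum_congr rfl fun a _ => Finset.sum_congr rfl fun i _ => ?_
  rw [partialDeriv_jacobian_comm hφ l i a]
  ring

variable [DecidableEq κ]

/-- The chain rule on the left and the product rule on the right, applied to the relation between η
and η'. Antisymmetry of η brings the two terms with second derivatives into the same shape, with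
opposite signs. -/
theorem partialDeriv_push (hφ : ContDiffAt ℂ 2 φ z) {η : (ι → ℂ) → (Fin 2 → ι) → ℂ}
    {η' : (κ → ℂ) → (Fin 2 → κ) → ℂ} (hη : ∀ k, DifferentiableAt ℂ (fun y => η y k) z)
    (hη' : ∀ k, DifferentiableAt ℂ (fun y => η' y k) (φ z)) (ha : IsAntisymm (η z))
    (h : ∀ᶠ y in nhds z, η' (φ y) = pushMultivector (fderiv ℂ φ y) (η y)) (i : ι) (k l : κ) :
    ∑ m, jacobian φ m i z * partialDeriv m (fun y => η' y ![k, l]) (φ z) =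
      ∑ a, partialDeriv i (jacobian φ k a) z * (∑ b, jacobian φ l b z * η z ![a, b]) -
      ∑ a, partialDeriv i (jacobian φ l a) z * (∑ b, jacobian φ k b z * η z ![a, b]) +
      ∑ a, ∑ b, jacobian φ k a z * jacobian φ l b z *
        partialDeriv i (fun y => η y ![a, b]) z := by
  have hJ := differentiableAt_jacobian hφ
  rw [← partialDeriv_comp (hη' ![k, l]) (hφ.differentiableAt (by norm_num)) i]
  have he : partialDeriv i (fun y => η' (φ y) ![k, l]) z = partialDeriv i (fun y =>
      ∑ a, ∑ b, jacobian φ k a y * jacobian φ l b y * η y ![a, b]) z := by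
    unfold partialDeriv
    rw [Filter.EventuallyEq.fderiv_eq]
    filter_upwards [h] with y hy
    rw [hy, pushMultivector_two]
  rw [he, partialDeriv_sum _ _ fun a _ => DifferentiableAt.fun_sum fun b _ =>
    ((hJ k a).fun_mul (hJ l b)).fun_mul (hη _)]
  have hs : ∑ a, partialDeriv i (jacobian φ l a) z * (∑ b, jacobian φ k b z * η z ![a, b]) =
      -∑ a, ∑ b, jacobian φ k a z * partialDeriv i (jacobian φ l b) z * η z ![a, b] := by
    simp only [Finset.mul_sum]
    rw [Finset.sum_comm]
    simp only [← Finset.sum_neg_distrib]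
    refine Finset.sum_congr rfl fun a _ => Finset.sum_congr rfl fun b _ => ?_
    rw [ha.swap_two a b]
    ring
  rw [hs, sub_neg_eq_add]
  simp only [Finset.mul_sum, ← Finset.sum_add_distrib]
  refine Finset.sum_congr rfl fun a _ => ?_
  rw [partialDeriv_sum _ _ fun b _ => ((hJ k a).fun_mul (hJ l b)).fun_mul (hη _)]
  refine Finset.sum_congr rfl fun b _ => ?_
  rw [partialDeriv_mul _ ((hJ k a).fun_mul (hJ l b)) (hη _),
    partialDeriv_mul _ (hJ k a) (hJ l b)]
  ring

/-- Half of the bracket is not natural by itself; this isolates its defect, which involves only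
second derivatives of φ. -/
theorem derivAlong_push (hφ : ContDiffAt ℂ 2 φ z) {θ η : (ι → ℂ) → (Fin 2 → ι) → ℂ}
    {θ' η' : (κ → ℂ) → (Fin 2 → κ) → ℂ} (hη : ∀ k, DifferentiableAt ℂ (fun y => η y k) z)
    (hη' : ∀ k, DifferentiableAt ℂ (fun y => η' y k) (φ z)) (ha : IsAntisymm (η z))
    (hθ : θ' (φ z) = pushMultivector (fderiv ℂ φ z) (θ z))
    (h : ∀ᶠ y in nhds z, η' (φ y) = pushMultivector (fderiv ℂ φ y) (η y)) (k : Fin 3 → κ) :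
    derivAlong θ' η' (φ z) k = pushMultivector (fderiv ℂ φ z) (derivAlong θ η z) k +
      secondOrderTerm φ (θ z) (η z) z (k 0) (k 1) (k 2) -
      secondOrderTerm φ (θ z) (η z) z (k 0) (k 2) (k 1) := by
  have h1 : derivAlong θ' η' (φ z) k = ∑ i, (∑ c, jacobian φ (k 0) c z * θ z ![i, c]) *
      ∑ m, jacobian φ m i z * partialDeriv m (fun y => η' y ![k 1, k 2]) (φ z) := by
    unfold derivAlong
    simp only [hθ, pushMultivector_two, Finset.mul_sum, Finset.sum_mul]
    rw [Finset.sum_comm]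
    refine Finset.sum_congr rfl fun i _ => ?_
    refine Finset.sum_congr rfl fun m _ => Finset.sum_congr rfl fun c _ => by ring
  have h2 : pushMultivector (fderiv ℂ φ z) (derivAlong θ η z) k =
      ∑ i, (∑ c, jacobian φ (k 0) c z * θ z ![i, c]) * ∑ a, ∑ b, jacobian φ (k 1) a z *
        jacobian φ (k 2) b z * partialDeriv i (fun y => η y ![a, b]) z := by
    rw [pushMultivector, sum_fin_three_fun]
    simp only [derivAlong, Finset.sum_mul]
    simp only [Finset.mul_sum]
    rw [sum_comm_three]
    refine Finset.sum_congr rfl fun i _ => Finset.sum_congr rfl fun c _ =>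
      Finset.sum_congr rfl fun a _ => Finset.sum_congr rfl fun b _ => ?_
    simp [Fin.prod_univ_three, jacobian]
    ring
  rw [h1, h2]
  simp only [partialDeriv_push hφ hη hη' ha h, secondOrderTerm]
  rw [← Finset.sum_add_distrib, ← Finset.sum_sub_distrib]
  refine Finset.sum_congr rfl fun i _ => ?_
  simp only [mul_assoc (∑ c, jacobian φ (k 0) c z * θ z ![i, c])]
  rw [← Finset.mul_sum, ← Finset.mul_sum]
  ring

/-- The Schouten bracket is compatible with holomorphic maps. -/
theorem schouten_push (hφ : ContDiffAt ℂ 2 φ z) {θ η : (ι → ℂ) → (Fin 2 → ι) → ℂ}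
    {θ' η' : (κ → ℂ) → (Fin 2 → κ) → ℂ} (dθ : ∀ k, DifferentiableAt ℂ (fun y => θ y k) z)
    (dη : ∀ k, DifferentiableAt ℂ (fun y => η y k) z)
    (dθ' : ∀ k, DifferentiableAt ℂ (fun y => θ' y k) (φ z))
    (dη' : ∀ k, DifferentiableAt ℂ (fun y => η' y k) (φ z))
    (aθ : IsAntisymm (θ z)) (aη : IsAntisymm (η z))
    (hθ : ∀ᶠ y in nhds z, θ' (φ y) = pushMultivector (fderiv ℂ φ y) (θ y))
    (hη : ∀ᶠ y in nhds z, η' (φ y) = pushMultivector (fderiv ℂ φ y) (η y)) :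
    schouten θ' η' (φ z) = pushMultivector (fderiv ℂ φ z) (schouten θ η z) := by
  have key : ∀ θ η : (Fin 2 → ι) → ℂ, (alternate fun k : Fin 3 → κ =>
      secondOrderTerm φ θ η z (k 0) (k 1) (k 2) - secondOrderTerm φ θ η z (k 0) (k 2) (k 1)) =
      (2 : ℂ) • alternate fun k : Fin 3 → κ => secondOrderTerm φ θ η z (k 0) (k 1) (k 2) := by
    intro θ η
    have := alternate_swap_one_two (secondOrderTerm φ θ η z)
    have e : (fun k : Fin 3 → κ => secondOrderTerm φ θ η z (k 0) (k 1) (k 2) -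
        secondOrderTerm φ θ η z (k 0) (k 2) (k 1)) =
        (fun k : Fin 3 → κ => secondOrderTerm φ θ η z (k 0) (k 1) (k 2)) +
        (-1 : ℂ) • fun k : Fin 3 → κ => secondOrderTerm φ θ η z (k 0) (k 2) (k 1) := by
      funext k
      simp [sub_eq_add_neg]
    rw [e, alternate_add, alternate_smul, this]
    module
  have h1 : derivAlong θ' η' (φ z) = pushMultivector (fderiv ℂ φ z) (derivAlong θ η z) +
      fun k => (secondOrderTerm φ (θ z) (η z) z (k 0) (k 1) (k 2) -
        secondOrderTerm φ (θ z) (η z) z (k 0) (k 2) (k 1)) := by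
    funext k
    rw [derivAlong_push hφ dη dη' aη hθ.self_of_nhds hη, Pi.add_apply, add_sub_assoc]
  have h2 : derivAlong η' θ' (φ z) = pushMultivector (fderiv ℂ φ z) (derivAlong η θ z) +
      fun k => (secondOrderTerm φ (η z) (θ z) z (k 0) (k 1) (k 2) -
        secondOrderTerm φ (η z) (θ z) z (k 0) (k 2) (k 1)) := by
    funext k
    rw [derivAlong_push hφ dθ dθ' aθ hη.self_of_nhds hθ, Pi.add_apply, add_sub_assoc]
  have h3 := alternate_swap_zero_two (secondOrderTerm φ (θ z) (η z) z)
  have aθ' : IsAntisymm (θ' (φ z)) := by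
    rw [hθ.self_of_nhds]; exact aθ.pushMultivector _
  have aη' : IsAntisymm (η' (φ z)) := by
    rw [hη.self_of_nhds]; exact aη.pushMultivector _
  rw [schouten_eq aθ' aη', schouten_eq aθ aη, h1, h2, alternate_add, alternate_add, key, key,
    pushMultivector_smul, pushMultivector_add, pushMultivector_alternate, pushMultivector_alternate]
  -- The defect of the second half is now that of the first with its outer indices exchanged. This
  -- is an odd permutation, so the two cancel after antisymmetrization.
  simp only [secondOrderTerm_comm hφ (θ z) (η z)]
  rw [h3]
  module

end

theorem contDiffAt_affineCoord (r : Fin 4) {z : Fin 4 → ℂ} (hz : z r ≠ 0) :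
    ContDiffAt ℂ 2 (affineCoord r) z := by
  rw [contDiffAt_pi]
  intro k
  unfold affineCoord
  exact ContDiffAt.div (contDiff_apply ℂ ℂ (k : Fin 4)).contDiffAt
    (contDiff_apply ℂ ℂ r).contDiffAt hz

/-- Naturality for the coordinate map of U_r, at the point of the fibre with z_r = 1, combined with
the computation on ℂ⁴. -/
theorem schouten_pushField (a a' : SymAlt 2) (r : Fin 4) :
    schouten (pushField a r) (pushField a' r) = pushField (Ftilde a a') r := by
  funext ζ
  have hz : affineVec r ζ r ≠ 0 := by simp
  have hp : ∀ b : SymAlt 2, ∀ᶠ y in nhds (affineVec r ζ),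
      pushField b r (affineCoord r y) =
        pushMultivector (fderiv ℂ (affineCoord r) y) (toField b y) := by
    intro b
    filter_upwards [(isOpen_apply_ne_zero r).mem_nhds hz] with y hy
    exact (push_toField_eq_pushField b r hy).symm
  have ht : ∀ (b : SymAlt 2) k, DifferentiableAt ℂ (fun y => toField b y k) (affineVec r ζ) :=
    fun b k => differentiable_tensorEval (fun i => b.1 i k) _
  have h := schouten_push (contDiffAt_affineCoord r hz) (ht a) (ht a')
    (fun k => differentiable_pushField a r k _) (fun k => differentiable_pushField a' r k _)
    (toField_isAntisymm a _) (toField_isAntisymm a' _) (hp a) (hp a')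
  rw [schouten_toField, push_toField_eq_pushField _ r hz, affineCoord_affineVec] at h
  exact h

/-! ### The kernel of `a ↦ dπ(w_a)` -/

/-- Two equal matrices give two equal vector fields in the wedge product: a transposition both fixes
the product and changes its sign. -/
theorem symAltProj_pureTensor_eq_zero {q : ℕ} {B : Fin q → Matrix (Fin 4) (Fin 4) ℂ} {i j : Fin q}
    (hij : i ≠ j) (h : B i = B j) : symAltProj q (pureTensor B) = 0 := by
  refine toField_injective fun z k => ?_
  rw [toField_symAltProj]
  simp only [tensorEval_pureTensor]
  have hB : ∀ m, B (Equiv.swap i j m) = B m := by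
    intro m
    rcases eq_or_ne m i with rfl | hi
    · simp [h]
    rcases eq_or_ne m j with rfl | hj
    · simp [h]
    rw [Equiv.swap_apply_of_ne_of_ne hi hj]
  have h1 := alternate_comp_perm (fun k : Fin q → Fin 4 => ∏ m, Matrix.vecMul z (B m) (k m))
    (Equiv.swap i j)
  have h2 : (fun k : Fin q → Fin 4 => ∏ m, Matrix.vecMul z (B m) ((k ∘ Equiv.swap i j) m)) =
      fun k => ∏ m, Matrix.vecMul z (B m) (k m) := by
    funext k
    refine Fintype.prod_equiv (Equiv.swap i j) _ _ fun m => ?_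
    rw [hB]
    rfl
  rw [h2, Equiv.Perm.sign_swap hij] at h1
  have h3 := congrFun h1 k
  simp only [Units.val_neg, Units.val_one, Int.cast_neg, Int.cast_one, neg_smul, one_smul,
    Pi.neg_apply] at h3
  rw [self_eq_neg.1 h3]
  simp [toField]

theorem pureTensor_update {q : ℕ} (B : Fin q → Matrix (Fin 4) (Fin 4) ℂ) (m : Fin q)
    (X Y : Matrix (Fin 4) (Fin 4) ℂ) (c : ℂ) :
    pureTensor (Function.update B m (X + c • Y)) =
      pureTensor (Function.update B m X) + c • pureTensor (Function.update B m Y) := by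
  have h : ∀ (Z : Matrix (Fin 4) (Fin 4) ℂ) i k, pureTensor (Function.update B m Z) i k =
      Z (i m) (k m) * ∏ l ∈ Finset.univ.erase m, B l (i l) (k l) := by
    intro Z i k
    rw [pureTensor, ← Finset.mul_prod_erase _ _ (Finset.mem_univ m), Function.update_self]
    congr 1
    refine Finset.prod_congr rfl fun l hl => ?_
    rw [Function.update_of_ne (Finset.ne_of_mem_erase hl)]
  funext i k
  simp only [h, Pi.add_apply, Pi.smul_apply, Matrix.add_apply, Matrix.smul_apply, smul_eq_mul]
  ring

/-- Here s is a set of positions whose matrices may still have a trace. Subtracting the scalar part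
at such a position changes the tensor by one with two factors E, whose projection is zero. -/
theorem symAltProj_pureTensor_mem_eulerPart {n : ℕ} (s : Finset (Fin n)) :
    ∀ B : Fin (n + 1) → Matrix (Fin 4) (Fin 4) ℂ, B (Fin.last n) = 1 →
      (∀ m, m ∉ s → B m.castSucc ∈ LieAlgebra.SpecialLinear.sl (Fin 4) ℂ) →
      symAltProj (n + 1) (pureTensor B) ∈ eulerPart n := by
  induction s using Finset.induction_on with
  | empty =>
    intro B h1 h2
    exact Submodule.mem_map_of_mem (Submodule.subset_span
      ⟨B, fun m => h2 m (by simp), h1 ▸ Submodule.mem_span_singleton_self _, rfl⟩)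
  | insert m s hm ih =>
    intro B h1 h2
    -- The 4 is the trace of the unit matrix.
    set c : ℂ := (B m.castSucc).trace / 4 with hc
    have hl : Fin.last n ≠ m.castSucc := (Fin.castSucc_lt_last m).ne'
    have hB : B = Function.update B m.castSucc ((B m.castSucc - c • 1) + c • 1) := by simp
    have h0 : symAltProj (n + 1) (pureTensor (Function.update B m.castSucc 1)) = 0 :=
      symAltProj_pureTensor_eq_zero hl (by rw [Function.update_of_ne hl, h1, Function.update_self])
    rw [hB, pureTensor_update, map_add, map_smul, h0, smul_zero, add_zero]
    refine ih _ ?_ fun l hls => ?_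
    · rw [Function.update_of_ne hl, h1]
    · rcases eq_or_ne l m with rfl | hlm
      · rw [Function.update_self]
        change Matrix.trace (B l.castSucc - c • (1 : Matrix (Fin 4) (Fin 4) ℂ)) = 0
        simp [hc]
      · rw [Function.update_of_ne (fun h => hlm (Fin.castSucc_injective _ h))]
        exact h2 l (by simp [hlm, hls])

/-- The tensor `c ⊗ E`. -/
def appendUnit {n : ℕ} (c : GlTensor n) : GlTensor (n + 1) :=
  fun i k => c (Fin.init i) (Fin.init k) * if i (Fin.last n) = k (Fin.last n) then 1 else 0

theorem appendUnit_eq_sum {n : ℕ} (c : GlTensor n) :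
    appendUnit c = ∑ i, ∑ k, c i k • pureTensor
      (Fin.snoc (fun m => Matrix.single (i m) (k m) (1 : ℂ)) 1 :
        Fin (n + 1) → Matrix (Fin 4) (Fin 4) ℂ) := by
  funext x y
  have h : ∀ i k : Fin n → Fin 4, pureTensor
      (Fin.snoc (fun m => Matrix.single (i m) (k m) (1 : ℂ)) 1 :
        Fin (n + 1) → Matrix (Fin 4) (Fin 4) ℂ) x y =
      if i = Fin.init x then (if k = Fin.init y then
        (if x (Fin.last n) = y (Fin.last n) then 1 else 0) else 0) else 0 := by
    intro i k
    rw [pureTensor, Fin.prod_univ_castSucc]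
    simp only [Fin.snoc_castSucc, Fin.snoc_last, Matrix.single_apply, Matrix.one_apply,
      Finset.prod_boole, Finset.mem_univ, true_imp_iff, forall_and]
    have e1 : (∀ m, i m = x m.castSucc) ↔ i = Fin.init x := funext_iff.symm
    have e2 : (∀ m, k m = y m.castSucc) ↔ k = Fin.init y := funext_iff.symm
    rw [if_congr (and_congr e1 e2) rfl rfl]
    split_ifs <;> simp_all
  simp [Finset.sum_apply, h, appendUnit]

/-- Expansion in matrix units reduces this to decomposable tensors, for which no tracelessness of
the other factors is needed. -/
theorem symAltProj_appendUnit_mem {n : ℕ} (c : GlTensor n) :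
    symAltProj (n + 1) (appendUnit c) ∈ eulerPart n := by
  rw [appendUnit_eq_sum, map_sum]
  refine Submodule.sum_mem _ fun i _ => ?_
  rw [map_sum]
  refine Submodule.sum_mem _ fun k _ => ?_
  rw [map_smul]
  refine Submodule.smul_mem _ _ (symAltProj_pureTensor_mem_eulerPart Finset.univ _ ?_ ?_)
  · simp
  · simp

theorem tensorEval_appendUnit {n : ℕ} (c : GlTensor n) (z : Fin 4 → ℂ) (k : Fin (n + 1) → Fin 4) :
    tensorEval (fun i => appendUnit c i k) z =
      tensorEval (fun i => c i (Fin.init k)) z * z (k (Fin.last n)) := by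
  unfold tensorEval
  rw [← (Fin.snocEquiv (fun _ : Fin (n + 1) => Fin 4)).sum_comp, Fintype.sum_prod_type,
    Finset.sum_comm, Finset.sum_mul]
  refine Finset.sum_congr rfl fun i _ => ?_
  have h : ∀ l : Fin 4, appendUnit c (Fin.snocEquiv (fun _ : Fin (n + 1) => Fin 4) (l, i)) k *
      ∏ m, z (Fin.snocEquiv (fun _ : Fin (n + 1) => Fin 4) (l, i) m) =
      c i (Fin.init k) * (if l = k (Fin.last n) then 1 else 0) * ((∏ m, z (i m)) * z l) := by
    intro l
    change appendUnit c (Fin.snoc i l : Fin (n + 1) → Fin 4) k *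
      ∏ m, z ((Fin.snoc i l : Fin (n + 1) → Fin 4) m) = _
    simp [appendUnit, Fin.prod_univ_castSucc]
  simp only [h]
  simp
  ring

/-- The contraction of `a` in one upper and one lower index. -/
def contract {n : ℕ} (a : SymAlt (n + 1)) : GlTensor n :=
  fun i k => ∑ m, a.1 (Fin.cons m i) (Fin.cons m k)

/-! ### Divergence, Euler's formula and the resulting description of the kernel -/

theorem sum_partialDeriv_toField {n : ℕ} (a : SymAlt (n + 1)) (z : Fin 4 → ℂ)
    (k : Fin n → Fin 4) :
    ∑ m, partialDeriv m (fun y => toField a y (Fin.cons m k)) z =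
      (n + 1) * tensorEval (fun i => contract a i k) z := by
  unfold contract
  rw [tensorEval_sum, Finset.mul_sum]
  exact Finset.sum_congr rfl fun m _ => partialDeriv_tensorEval (SymAlt_isSymm a _) m z

theorem sum_mul_partialDeriv_toField {n : ℕ} (a : SymAlt (n + 1)) (z : Fin 4 → ℂ)
    (k : Fin (n + 1) → Fin 4) :
    ∑ m, z m * partialDeriv m (fun y => toField a y k) z = (n + 1) * toField a z k := by
  rw [toField_eq_tensorEval, tensorEval_succ, Finset.mul_sum]
  refine Finset.sum_congr rfl fun m _ => ?_
  have h : partialDeriv m (fun y => toField a y k) z = _ :=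
    partialDeriv_tensorEval (SymAlt_isSymm a k) m z
  rw [h]
  ring

theorem partialDeriv_coord_mul_toField {q : ℕ} (a : SymAlt q) (z : Fin 4 → ℂ) (m l : Fin 4)
    (k : Fin q → Fin 4) :
    partialDeriv m (fun y => y l * toField a y k) z =
      z l * partialDeriv m (fun y => toField a y k) z + if l = m then toField a z k else 0 := by
  have h : DifferentiableAt ℂ (fun y => toField a y k) z :=
    differentiable_tensorEval (fun i => a.1 i k) z
  rw [partialDeriv_mul m (by fun_prop) h, partialDeriv_coord]
  split_ifs <;> simp

/-- The divergence of z ∧ w_a = 0 in the first index. The leading term gives (4 + 2) w_a, namely the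
dimension plus the degree; each of the other two gives -w_a and one term of z ∧ div w_a. The total
is 4 w_a. -/
theorem toField_eq_of_eulerWedge_two {a : SymAlt 2}
    (h : ∀ z b c d, eulerWedge z (toField a z) ![b, c, d] = 0) (z : Fin 4 → ℂ) (b c : Fin 4) :
    4 * toField a z ![b, c] = 2 * (z b * tensorEval (fun i => contract a i ![c]) z -
      z c * tensorEval (fun i => contract a i ![b]) z) := by
  have ht : ∀ k, Differentiable ℂ (fun y => toField a y k) :=
    fun k => differentiable_tensorEval (fun i => a.1 i k)
  have h1 : ∀ m, partialDeriv m (fun y => y m * toField a y ![b, c]) z -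
      partialDeriv m (fun y => y b * toField a y ![m, c]) z +
      partialDeriv m (fun y => y c * toField a y ![m, b]) z = 0 := by
    intro m
    have e : (fun y => y m * toField a y ![b, c] - y b * toField a y ![m, c] +
        y c * toField a y ![m, b]) = fun _ => 0 := by
      funext y
      rw [← eulerWedge_two, h]
    have e' := congrArg (fun f => partialDeriv m f z) e
    have d : ∀ l k, DifferentiableAt ℂ (fun y : Fin 4 → ℂ => y l * toField a y k) z :=
      fun l k => DifferentiableAt.fun_mul (by fun_prop) (ht k z)
    simp only [partialDeriv] at e' ⊢
    rw [fderiv_fun_add ((d _ _).fun_sub (d _ _)) (d _ _), fderiv_fun_sub (d _ _) (d _ _)] at e'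
    simpa using e'
  have h2 := Finset.sum_eq_zero fun m (_ : m ∈ Finset.univ) => h1 m
  simp only [partialDeriv_coord_mul_toField, Finset.sum_add_distrib, Finset.sum_sub_distrib,
    ← Finset.mul_sum] at h2
  have g : ∀ c, ∑ m, partialDeriv m (fun y => toField a y ![m, c]) z =
      2 * tensorEval (fun i => contract a i ![c]) z := fun c => by
    refine (sum_partialDeriv_toField a z ![c]).trans ?_
    norm_num
  rw [g, g, sum_mul_partialDeriv_toField] at h2
  simp at h2
  rw [(toField_isAntisymm a z).swap_two b c] at h2
  linear_combination h2

/-- As for bivectors: the degree 3 in 4 + 3 is offset by three terms -w_a, so the factor is again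
the dimension 4. -/
theorem toField_eq_of_eulerWedge_three {a : SymAlt 3}
    (h : ∀ z b c d e, eulerWedge z (toField a z) ![b, c, d, e] = 0) (z : Fin 4 → ℂ)
    (b c d : Fin 4) :
    4 * toField a z ![b, c, d] = 3 * (z b * tensorEval (fun i => contract a i ![c, d]) z -
      z c * tensorEval (fun i => contract a i ![b, d]) z +
      z d * tensorEval (fun i => contract a i ![b, c]) z) := by
  have ht : ∀ k, Differentiable ℂ (fun y => toField a y k) :=
    fun k => differentiable_tensorEval (fun i => a.1 i k)
  have h1 : ∀ m, partialDeriv m (fun y => y m * toField a y ![b, c, d]) z -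
      partialDeriv m (fun y => y b * toField a y ![m, c, d]) z +
      partialDeriv m (fun y => y c * toField a y ![m, b, d]) z -
      partialDeriv m (fun y => y d * toField a y ![m, b, c]) z = 0 := by
    intro m
    have e : (fun y => y m * toField a y ![b, c, d] - y b * toField a y ![m, c, d] +
        y c * toField a y ![m, b, d] - y d * toField a y ![m, b, c]) = fun _ => 0 := by
      funext y
      rw [← eulerWedge_three, h]
    have e' := congrArg (fun f => partialDeriv m f z) e
    have d : ∀ l k, DifferentiableAt ℂ (fun y : Fin 4 → ℂ => y l * toField a y k) z :=
      fun l k => DifferentiableAt.fun_mul (by fun_prop) (ht k z)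
    simp only [partialDeriv] at e' ⊢
    rw [fderiv_fun_sub (((d _ _).fun_sub (d _ _)).fun_add (d _ _)) (d _ _),
      fderiv_fun_add ((d _ _).fun_sub (d _ _)) (d _ _), fderiv_fun_sub (d _ _) (d _ _)] at e'
    simpa using e'
  have h2 := Finset.sum_eq_zero fun m (_ : m ∈ Finset.univ) => h1 m
  simp only [partialDeriv_coord_mul_toField, Finset.sum_add_distrib, Finset.sum_sub_distrib,
    ← Finset.mul_sum] at h2
  have g : ∀ c d, ∑ m, partialDeriv m (fun y => toField a y ![m, c, d]) z =
      3 * tensorEval (fun i => contract a i ![c, d]) z := fun c d => by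
    refine (sum_partialDeriv_toField a z ![c, d]).trans ?_
    norm_num
  rw [g, g, g, sum_mul_partialDeriv_toField] at h2
  simp at h2
  have s := toField_isAntisymm a z
  rw [s.swap_three_left b d c, s.swap_three_right b c d, s.swap_three_left b c d] at h2
  linear_combination h2

theorem alternate_swap_two {ι : Type} (t : ι → ι → ℂ) :
    alternate (fun k : Fin 2 → ι => t (k 1) (k 0)) =
      -alternate fun k : Fin 2 → ι => t (k 0) (k 1) := by
  have h := alternate_comp_perm (fun k : Fin 2 → ι => t (k 0) (k 1)) (Equiv.swap 0 1)
  simpa using h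

theorem eq_symAltProj_of_eulerWedge_two {a : SymAlt 2}
    (h : ∀ z b c d, eulerWedge z (toField a z) ![b, c, d] = 0) :
    -- Solving for w_a gives the factor 1/2 and two terms, each equal to minus the alternation of
    -- contraction times z.
    a = symAltProj 2 ((-1 : ℂ) • appendUnit (contract a)) := by
  refine toField_injective fun z k => congrFun ?_ k
  rw [map_smul, toField_const_smul, toField_symAltProj]
  rw [← (toField_isAntisymm a z).alternate_eq, ← alternate_smul]
  have hs := alternate_swap_two fun b c => tensorEval (fun i => contract a i ![b]) z * z c
  have hi : ∀ k : Fin 2 → Fin 4, Fin.init k = ![k 0] := fun k => by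
    funext l; fin_cases l; rfl
  have hw : toField a z = (1 / 2 : ℂ) •
      ((fun k : Fin 2 → Fin 4 => tensorEval (fun i => contract a i ![k 1]) z * z (k 0)) +
      (-1 : ℂ) • fun k : Fin 2 → Fin 4 => tensorEval (fun i => contract a i ![k 0]) z * z (k 1)) := by
    funext k
    have e := toField_eq_of_eulerWedge_two h z (k 0) (k 1)
    rw [show ![k 0, k 1] = k by funext l; fin_cases l <;> rfl] at e
    simp only [Pi.smul_apply, Pi.add_apply, smul_eq_mul]
    linear_combination e / 4
  rw [hw, alternate_smul, alternate_add, alternate_smul, alternate_smul, hs]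
  simp only [tensorEval_appendUnit, hi]
  rw [show (Fin.last 1) = 1 from rfl]
  module

theorem eq_symAltProj_of_eulerWedge_three {a : SymAlt 3}
    (h : ∀ z b c d e, eulerWedge z (toField a z) ![b, c, d, e] = 0) :
    -- Solving for w_a gives the factor 3/4 and three terms with the same alternation.
    a = symAltProj 3 ((9 / 4 : ℂ) • appendUnit (contract a)) := by
  refine toField_injective fun z k => congrFun ?_ k
  rw [map_smul, toField_const_smul, toField_symAltProj]
  rw [← (toField_isAntisymm a z).alternate_eq, ← alternate_smul]
  let F := fun b c d => tensorEval (fun i => contract a i ![b, c]) z * z d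
  have hs := alternate_swap_one_two F
  have hr := alternate_rotate fun b c d => F c d b
  have hi : ∀ k : Fin 3 → Fin 4, Fin.init k = ![k 0, k 1] := fun k => by
    funext l; fin_cases l <;> rfl
  have hw : toField a z = (3 / 4 : ℂ) •
      ((fun k : Fin 3 → Fin 4 => F (k 1) (k 2) (k 0)) +
      ((-1 : ℂ) • (fun k : Fin 3 → Fin 4 => F (k 0) (k 2) (k 1)) +
      fun k : Fin 3 → Fin 4 => F (k 0) (k 1) (k 2))) := by
    funext k
    have e := toField_eq_of_eulerWedge_three h z (k 0) (k 1) (k 2)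
    rw [show ![k 0, k 1, k 2] = k by funext l; fin_cases l <;> rfl] at e
    simp only [Pi.smul_apply, Pi.add_apply, smul_eq_mul, F]
    linear_combination e / 4
  rw [hw, alternate_smul, alternate_add, alternate_add, alternate_smul, alternate_smul, hs, ← hr]
  simp only [tensorEval_appendUnit, hi]
  rw [show (Fin.last 2) = 2 from rfl]
  module

theorem ker_pushforwardMap_two : LinearMap.ker (pushforwardMap 2) = eulerPart 1 := by
  refine le_antisymm (fun a ha => ?_) (eulerPart_le_ker 1)
  rw [eq_symAltProj_of_eulerWedge_two (a := a), map_smul]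
  · exact Submodule.smul_mem _ _ (symAltProj_appendUnit_mem _)
  intro z b c d
  by_cases hz : z = 0
  · simp [hz, eulerWedge]
  obtain ⟨r, hr⟩ := Function.ne_iff.1 hz
  exact eulerWedge_eq_zero_of_push_two r hr (toField_isAntisymm a z)
    (push_toField_of_mem_ker ha r hr) b c d

theorem ker_pushforwardMap_three : LinearMap.ker (pushforwardMap 3) = eulerPart 2 := by
  refine le_antisymm (fun a ha => ?_) (eulerPart_le_ker 2)
  rw [eq_symAltProj_of_eulerWedge_three (a := a), map_smul]
  · exact Submodule.smul_mem _ _ (symAltProj_appendUnit_mem _)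
  intro z b c d e
  by_cases hz : z = 0
  · simp [hz, eulerWedge]
  obtain ⟨r, hr⟩ := Function.ne_iff.1 hz
  exact eulerWedge_eq_zero_of_push_three r hr (toField_isAntisymm a z)
    (push_toField_of_mem_ker ha r hr) b c d e

/-! ### Entire homogeneous functions -/

/-- A Liouville argument by induction: the difference quotient of g at 0 is again entire and its
growth exponent is lower by one. Compactness bounds it on the unit disc, the growth of g outside. -/
theorem exists_polynomial_of_growth (n : ℕ) : ∀ {g : ℂ → ℂ} (_ : Differentiable ℂ g) {C : ℝ}
    (_ : ∀ t, ‖g t‖ ≤ C * (1 + ‖t‖) ^ n),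
    ∃ p : Polynomial ℂ, p.natDegree ≤ n ∧ ∀ t, g t = p.eval t := by
  induction n with
  | zero =>
    intro g hg C hC
    have hb : Bornology.IsBounded (Set.range g) := by
      refine (Metric.isBounded_closedBall (x := (0 : ℂ)) (r := C)).subset ?_
      rintro _ ⟨t, rfl⟩
      simpa using hC t
    refine ⟨Polynomial.C (g 0), by simp, fun t => ?_⟩
    rw [Polynomial.eval_C]
    exact hg.apply_eq_apply_of_bounded hb t 0
  | succ n ih =>
    intro g hg C hC
    have hd : Differentiable ℂ (dslope g 0) := by
      rw [← differentiableOn_univ, Complex.differentiableOn_dslope Filter.univ_mem]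
      exact hg.differentiableOn
    obtain ⟨M, hM⟩ := (isCompact_closedBall (0 : ℂ) 1).exists_bound_of_continuousOn
      hd.continuous.continuousOn
    have hM0 : 0 ≤ M := (norm_nonneg _).trans (hM 0 (by simp))
    have hC0 : 0 ≤ C := by simpa using (norm_nonneg _).trans (hC 0)
    obtain ⟨p, hp, hpe⟩ := ih hd (C := 4 * C + M) fun t => by
      have h1 : 1 ≤ (1 + ‖t‖) ^ n := one_le_pow₀ (by linarith [norm_nonneg t])
      rcases le_or_gt ‖t‖ 1 with ht | ht
      · have := hM t (by simpa using ht)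
        nlinarith
      · have ht0 : t ≠ 0 := by rintro rfl; simp at ht; linarith
        rw [dslope_of_ne _ ht0, slope_def_field, sub_zero, norm_div, div_le_iff₀ (by linarith)]
        have h2 := norm_sub_le (g t) (g 0)
        have h3 := hC t
        have h4 := hC 0
        simp only [norm_zero, add_zero, one_pow, mul_one] at h4
        rw [pow_succ] at h3
        have h5 : C * ((1 + ‖t‖) ^ n * (1 + ‖t‖)) ≤ C * ((1 + ‖t‖) ^ n * (2 * ‖t‖)) := by
          gcongr
          linarith
        have h6 : C * 1 ≤ C * ((1 + ‖t‖) ^ n * ‖t‖) := by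
          gcongr
          nlinarith
        have h7 : 0 ≤ C * ((1 + ‖t‖) ^ n * ‖t‖) := by positivity
        have h8 : 0 ≤ M * (1 + ‖t‖) ^ n * ‖t‖ := by positivity
        nlinarith
    refine ⟨Polynomial.C (g 0) + Polynomial.X * p, ?_, fun t => ?_⟩
    · refine (Polynomial.natDegree_add_le _ _).trans (max_le (by simp) ?_)
      refine Polynomial.natDegree_mul_le.trans ?_
      have := Polynomial.natDegree_X_le (R := ℂ)
      omega
    · simp only [Polynomial.eval_add, Polynomial.eval_C, Polynomial.eval_mul, Polynomial.eval_X,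
        ← hpe]
      have := sub_smul_dslope g 0 t
      simp only [sub_zero, smul_eq_mul] at this
      rw [this]
      ring

/-- The derivative of an entire function of cubic growth is a finite combination of its values. -/
theorem deriv_eq_of_cubic_growth {g : ℂ → ℂ} (hg : Differentiable ℂ g) {C : ℝ}
    (hC : ∀ t, ‖g t‖ ≤ C * (1 + ‖t‖) ^ 3) :
    deriv g 0 = -11 / 6 * g 0 + 3 * g 1 - 3 / 2 * g 2 + 1 / 3 * g 3 := by
  -- The growth makes g a polynomial of degree at most 3, for which the forward difference formula
  -- on the nodes 0, 1, 2, 3 is exact.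
  obtain ⟨p, hp, h⟩ := exists_polynomial_of_growth 3 hg hC
  have hg' : g = fun t => p.eval t := funext h
  have he : ∀ t, p.eval t = _ := fun t => Polynomial.eval_eq_sum_range' (n := 4) (by omega) t
  rw [hg', Polynomial.deriv, ← Polynomial.coeff_zero_eq_eval_zero, Polynomial.coeff_derivative]
  simp only [he]
  simp [Finset.sum_range_succ]
  ring

section
variable {E : Type} [NormedAddCommGroup E] [NormedSpace ℂ E] {n : ℕ}
  {h : E → ℂ}

theorem norm_eq_of_homogeneous (hom : ∀ (c : ℂ) (z : E), c ≠ 0 → h (c • z) = c ^ n * h z) {z : E}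
    (hz : z ≠ 0) : ‖h z‖ = ‖z‖ ^ n * ‖h ((‖z‖⁻¹ : ℂ) • z)‖ := by
  have hz' : (‖z‖ : ℂ) ≠ 0 := by simpa using hz
  have e := hom ‖z‖ ((‖z‖⁻¹ : ℂ) • z) hz'
  rw [smul_smul, mul_inv_cancel₀ hz', one_smul] at e
  conv_lhs => rw [e]
  simp

/-- Homogeneity reduces the bound to the unit sphere. The exponent 3 is kept for all n ≤ 3, so that
one difference formula serves every degree. -/
theorem exists_cubic_bound [FiniteDimensional ℂ E] (hn : n ≤ 3) (hd : Differentiable ℂ h)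
    (hom : ∀ (c : ℂ) (z : E), c ≠ 0 → h (c • z) = c ^ n * h z) :
    ∃ C : ℝ, 0 ≤ C ∧ ∀ z, ‖h z‖ ≤ C * (1 + ‖z‖) ^ 3 := by
  have : ProperSpace E := FiniteDimensional.proper ℂ E
  obtain ⟨C, hC⟩ := (isCompact_closedBall (0 : E) 1).exists_bound_of_continuousOn
    hd.continuous.continuousOn
  have hC0 : 0 ≤ C := (norm_nonneg _).trans (hC 0 (by simp))
  refine ⟨C, hC0, fun z => ?_⟩
  have h1 : 1 ≤ 1 + ‖z‖ := by linarith [norm_nonneg z]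
  by_cases hz : z = 0
  · have := hC z (by simp [hz])
    nlinarith [one_le_pow₀ h1 (n := 3)]
  · rw [norm_eq_of_homogeneous hom hz, mul_comm]
    have hz' : ‖z‖ ≠ 0 := norm_ne_zero_iff.2 hz
    have h2 := hC ((‖z‖⁻¹ : ℂ) • z) (by simp [norm_smul, hz'])
    gcongr
    calc ‖z‖ ^ n ≤ (1 + ‖z‖) ^ n := by gcongr; linarith
      _ ≤ (1 + ‖z‖) ^ 3 := pow_le_pow_right₀ h1 hn

/-- At the origin h is O(‖z‖ⁿ) with n > 1, by compactness of the unit sphere, so its derivative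
there exists and is zero. -/
theorem differentiable_of_homogeneous [FiniteDimensional ℂ E] (hn : 1 < n) (h0 : h 0 = 0)
    (hd : ∀ z, z ≠ 0 → DifferentiableAt ℂ h z)
    (hom : ∀ (c : ℂ) (z : E), c ≠ 0 → h (c • z) = c ^ n * h z) : Differentiable ℂ h := by
  have : ProperSpace E := FiniteDimensional.proper ℂ E
  intro z
  by_cases hz : z = 0
  · subst hz
    obtain ⟨C, hC⟩ := (isCompact_sphere (0 : E) 1).exists_bound_of_continuousOn (f := h)
      fun z hz => (hd z (by rintro rfl; simp at hz)).continuousAt.continuousWithinAt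
    refine (Asymptotics.IsBigO.hasFDerivAt (n := n) ?_ hn).differentiableAt
    refine Asymptotics.IsBigO.of_bound C (Filter.Eventually.of_forall fun z => ?_)
    by_cases hz : z = 0
    · subst hz
      simp [h0, zero_pow (by omega : n ≠ 0)]
    · have hz' : ‖z‖ ≠ 0 := norm_ne_zero_iff.2 hz
      rw [norm_eq_of_homogeneous hom hz, sub_zero, norm_pow, norm_norm, mul_comm]
      gcongr
      exact hC _ (by simp [norm_smul, hz'])
  · exact hd z hz

end

/-- The one-variable formula on the line through z in the direction j. It exhibits the partial
derivative as a combination of translates of h, hence as an entire function. -/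
theorem partialDeriv_eq_of_cubic_growth {h : (Fin 4 → ℂ) → ℂ} (hd : Differentiable ℂ h) {C : ℝ}
    (hC0 : 0 ≤ C) (hC : ∀ z, ‖h z‖ ≤ C * (1 + ‖z‖) ^ 3) (j : Fin 4) (z : Fin 4 → ℂ) :
    partialDeriv j h z = -11 / 6 * h z + 3 * h (z + Pi.single j 1) -
      3 / 2 * h (z + (2 : ℂ) • Pi.single j 1) + 1 / 3 * h (z + (3 : ℂ) • Pi.single j 1) := by
  set e : Fin 4 → ℂ := Pi.single j 1 with he
  have hl : HasDerivAt (fun t : ℂ => z + t • e) e 0 := by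
    simpa using ((hasDerivAt_id (0 : ℂ)).smul_const e).const_add z
  have hg : Differentiable ℂ fun t : ℂ => h (z + t • e) := hd.comp (by fun_prop)
  have hb : ∀ t : ℂ, ‖h (z + t • e)‖ ≤ C * (1 + ‖z‖) ^ 3 * (1 + ‖t‖) ^ 3 := by
    intro t
    refine (hC _).trans ?_
    rw [mul_assoc, ← mul_pow]
    gcongr
    have h1 : ‖z + t • e‖ ≤ ‖z‖ + ‖t‖ := by
      refine (norm_add_le _ _).trans ?_
      rw [norm_smul, he, Pi.norm_single]
      simp
    nlinarith [norm_nonneg z, norm_nonneg t]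
  have h1 := deriv_eq_of_cubic_growth hg hb
  have h2 : HasDerivAt (fun t : ℂ => h (z + t • e)) (fderiv ℂ h z e) 0 := by
    have h3 : HasFDerivAt h (fderiv ℂ h z) (z + (0 : ℂ) • e) := by
      simpa using (hd z).hasFDerivAt
    exact h3.comp_hasDerivAt 0 hl
  rw [h2.deriv] at h1
  simpa [partialDeriv] using h1

/-- Both sides are the derivative of t ↦ h(tz) at t = 1. -/
theorem euler_identity {h : (Fin 4 → ℂ) → ℂ} (hd : Differentiable ℂ h) {n : ℕ}
    (hom : ∀ (c : ℂ) (z : Fin 4 → ℂ), c ≠ 0 → h (c • z) = c ^ n * h z) (z : Fin 4 → ℂ) :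
    n * h z = ∑ j, z j * partialDeriv j h z := by
  have h1 : HasDerivAt (fun t : ℂ => h (t • z)) (fderiv ℂ h z z) 1 := by
    have h3 : HasFDerivAt h (fderiv ℂ h z) ((1 : ℂ) • z) := by
      simpa using (hd z).hasFDerivAt
    exact h3.comp_hasDerivAt 1 (by simpa using (hasDerivAt_id (1 : ℂ)).smul_const z)
  have h2 : HasDerivAt (fun t : ℂ => t ^ n * h z) (n * h z) 1 := by
    simpa using (hasDerivAt_pow n (1 : ℂ)).mul_const (h z)
  have h3 : (fun t : ℂ => h (t • z)) =ᶠ[nhds 1] fun t : ℂ => t ^ n * h z := by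
    filter_upwards [isOpen_ne.mem_nhds (one_ne_zero : (1 : ℂ) ≠ 0)] with t ht
    exact hom t z ht
  rw [(h2.congr_of_eventuallyEq h3).unique h1]
  have h4 := congrArg (fderiv ℂ h z) (pi_eq_sum_univ' z)
  rw [h4, map_sum]
  simp [partialDeriv]

theorem partialDeriv_homogeneous {h : (Fin 4 → ℂ) → ℂ} (hd : Differentiable ℂ h) {n : ℕ}
    (hom : ∀ (c : ℂ) (z : Fin 4 → ℂ), c ≠ 0 → h (c • z) = c ^ (n + 1) * h z) (j : Fin 4) (c : ℂ)
    (z : Fin 4 → ℂ) (hc : c ≠ 0) : partialDeriv j h (c • z) = c ^ n * partialDeriv j h z := by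
  have h1 : HasFDerivAt (fun y => h (c • y)) ((fderiv ℂ h (c • z)).comp
      (c • ContinuousLinearMap.id ℂ (Fin 4 → ℂ))) z :=
    (hd (c • z)).hasFDerivAt.comp z ((hasFDerivAt_id z).const_smul c)
  have h2 : HasFDerivAt (fun y => h (c • y)) (c ^ (n + 1) • fderiv ℂ h z) z := by
    simp only [hom c _ hc]
    exact (hd z).hasFDerivAt.const_mul _
  have h3 := congrArg (fun L => L (Pi.single j 1)) (h1.unique h2)
  simp only [ContinuousLinearMap.comp_apply, _root_.smul_apply, ContinuousLinearMap.id_apply,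
    map_smul, smul_eq_mul] at h3
  refine mul_left_cancel₀ hc (h3.trans ?_)
  rw [partialDeriv, pow_succ]
  ring

/-- An entire homogeneous function of degree at most three is a form. -/
theorem exists_tensorEval_of_homogeneous {n : ℕ} : ∀ (_ : n ≤ 3) {h : (Fin 4 → ℂ) → ℂ}
    (_ : Differentiable ℂ h)
    (_ : ∀ (c : ℂ) (z : Fin 4 → ℂ), c ≠ 0 → h (c • z) = c ^ n * h z),
    ∃ c : (Fin n → Fin 4) → ℂ, h = tensorEval c := by
  induction n with
  | zero =>
    intro _ h hd hom
    refine ⟨fun _ => h 0, funext fun z => ?_⟩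
    rw [tensorEval_zero _ z ![]]
    -- In degree 0, h is constant on each punctured line through 0; by continuity its value there is
    -- h 0.
    have h1 : (fun c : ℂ => h (c • z)) = fun _ => h z := by
      refine Continuous.ext_on (dense_compl_singleton (0 : ℂ))
        (hd.continuous.comp (by fun_prop)) continuous_const fun c hc => ?_
      simpa using hom c z hc
    simpa using (congrFun h1 0).symm
  | succ n ih =>
    intro hn h hd hom
    obtain ⟨C, hC0, hC⟩ := exists_cubic_bound hn hd hom
    have hp : ∀ j, Differentiable ℂ (partialDeriv j h) := fun j => by
      rw [funext fun z => partialDeriv_eq_of_cubic_growth hd hC0 hC j z]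
      have hs : ∀ v, Differentiable ℂ fun z => h (z + v) := fun v => hd.comp (by fun_prop)
      have h1 := hs (Pi.single j 1)
      have h2 := hs ((2 : ℂ) • Pi.single j 1)
      have h3 := hs ((3 : ℂ) • Pi.single j 1)
      fun_prop
    choose c hc using fun j => ih (by omega) (hp j) (partialDeriv_homogeneous hd hom j)
    -- Euler's identity reassembles h from its partial derivatives, which are forms by induction.
    refine ⟨fun i => (n + 1 : ℂ)⁻¹ * c (i 0) (Fin.tail i), funext fun z => ?_⟩
    have hn : (n + 1 : ℂ) ≠ 0 := Nat.cast_add_one_ne_zero n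
    rw [tensorEval_const_mul, tensorEval_succ, eq_inv_mul_iff_mul_eq₀ hn]
    simp only [Fin.cons_zero, Fin.tail_cons, ← hc]
    simpa using euler_identity hd hom z

/-! ### Every holomorphic bivector on `ℂP³` comes from an invariant bivector -/

theorem isAntisymm_of_swap {ι : Type} {q : ℕ} {t : (Fin q → ι) → ℂ}
    (h : ∀ (i j : Fin q) (k : Fin q → ι), i ≠ j → t (k ∘ Equiv.swap i j) = -t k) :
    IsAntisymm t := by
  intro τ
  induction τ using Equiv.Perm.swap_induction_on with
  | one => simp
  | swap_mul f i j hij ih =>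
    intro k
    rw [Equiv.Perm.coe_mul, ← Function.comp_assoc, ih, h i j k hij, Equiv.Perm.sign_mul,
      Equiv.Perm.sign_swap hij]
    simp

theorem isAntisymm_two {ι : Type} {t : (Fin 2 → ι) → ℂ} (h : ∀ a b, t ![b, a] = -t ![a, b]) :
    IsAntisymm t := by
  have e : ∀ k : Fin 2 → ι, k = ![k 0, k 1] := fun k => by funext l; fin_cases l <;> rfl
  refine isAntisymm_of_swap fun i j k hij => ?_
  rw [e (k ∘ _), e k]
  fin_cases i <;> fin_cases j
  all_goals first | exact absurd rfl hij | simp [h (k 0) (k 1)]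

theorem isAntisymm_three {ι : Type} {t : (Fin 3 → ι) → ℂ}
    (h : ∀ a b c, t ![b, a, c] = -t ![a, b, c]) (h' : ∀ a b c, t ![a, c, b] = -t ![a, b, c]) :
    IsAntisymm t := by
  have e : ∀ k : Fin 3 → ι, k = ![k 0, k 1, k 2] := fun k => by funext l; fin_cases l <;> rfl
  have h'' : ∀ a b c, t ![c, b, a] = -t ![a, b, c] := fun a b c => by
    rw [h b c a, h' b a c, h a b c]
    ring
  refine isAntisymm_of_swap fun i j k hij => ?_
  rw [e (k ∘ _), e k]
  fin_cases i <;> fin_cases j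
  all_goals first
    | exact absurd rfl hij
    | simp [Equiv.swap_apply_of_ne_of_ne, h (k 0) (k 1) (k 2), h' (k 0) (k 1) (k 2),
        h'' (k 0) (k 1) (k 2)]

theorem IsAntisymm.eulerWedge {t : (Fin 2 → Fin 4) → ℂ} (ht : IsAntisymm t) (z : Fin 4 → ℂ) :
    IsAntisymm (eulerWedge z t) := by
  refine isAntisymm_three (fun a b c => ?_) fun a b c => ?_
  · rw [eulerWedge_two, eulerWedge_two, ht.swap_two a b]
    ring
  · rw [eulerWedge_two, eulerWedge_two, ht.swap_two b c]
    ring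

theorem eulerWedge_smul {q : ℕ} (c d : ℂ) (z : Fin 4 → ℂ) (t : (Fin q → Fin 4) → ℂ) :
    eulerWedge (c • z) (d • t) = (c * d) • eulerWedge z t := by
  funext k
  simp only [eulerWedge, Pi.smul_apply, smul_eq_mul, Finset.mul_sum]
  exact Finset.sum_congr rfl fun m _ => by ring

theorem eulerWedge_sub {q : ℕ} (z : Fin 4 → ℂ) (s t : (Fin q → Fin 4) → ℂ) :
    eulerWedge z (s - t) = eulerWedge z s - eulerWedge z t := by
  funext k
  simp [eulerWedge, mul_sub, Finset.sum_sub_distrib]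

theorem mk_mem_affineOpen (r : Fin 4) {z : Fin 4 → ℂ} (hz : z ≠ 0) (hr : z r ≠ 0) :
    Projectivization.mk ℂ z hz ∈ affineOpen r := by
  obtain ⟨a, ha⟩ := Projectivization.exists_smul_eq_mk_rep ℂ z hz
  change (Projectivization.mk ℂ z hz).rep r ≠ 0
  rw [← ha]
  simpa [Units.smul_def] using hr

/-- The lift of a holomorphic bivector over `U_r` to an invariant bivector without `∂_r`-part. -/
noncomputable def liftField (θ : HolMultivector 2) (r : Fin 4) (z : Fin 4 → ℂ) :
    (Fin 2 → Fin 4) → ℂ :=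
  fun k => if h : ∀ m, k m ≠ r then
    z r ^ 2 * θ.1 r (affineCoord r z) fun m => ⟨k m, h m⟩ else 0

theorem liftField_isAntisymm (θ : HolMultivector 2) (r : Fin 4) (z : Fin 4 → ℂ) :
    IsAntisymm (liftField θ r z) := by
  intro τ k
  have h : (∀ m, (k ∘ τ) m ≠ r) ↔ ∀ m, k m ≠ r :=
    ⟨fun h m => by simpa using h (τ.symm m), fun h m => h _⟩
  by_cases hk : ∀ m, k m ≠ r
  · rw [liftField, liftField, dif_pos hk, dif_pos (h.2 hk), mul_left_comm]
    congr 1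
    exact θ.2.1 r (affineCoord r z) τ fun m => ⟨k m, hk m⟩
  · rw [liftField, liftField, dif_neg hk, dif_neg (mt h.1 hk), mul_zero]

theorem liftField_smul (θ : HolMultivector 2) (r : Fin 4) {c : ℂ} (hc : c ≠ 0) (z : Fin 4 → ℂ) :
    liftField θ r (c • z) = c ^ 2 • liftField θ r z := by
  funext k
  simp only [liftField, affineCoord_smul r c hc, Pi.smul_apply, smul_eq_mul]
  split_ifs
  · ring
  · ring

/-- Without a ∂_r-part only the term z_r t of z ∧ t remains, and the factor z_r² in the lift
compensates for z_r / z_r³. -/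
theorem push_liftField (θ : HolMultivector 2) (r : Fin 4) {z : Fin 4 → ℂ} (hz : z r ≠ 0) :
    pushMultivector (fderiv ℂ (affineCoord r) z) (liftField θ r z) =
      θ.1 r (affineCoord r z) := by
  funext k
  rw [pushMultivector_affineCoord_two r hz (liftField_isAntisymm θ r z), eulerWedge_two]
  have h1 : ∀ a, liftField θ r z ![r, a] = 0 := fun a =>
    dif_neg fun h => h 0 rfl
  have h2 : liftField θ r z ![k 0, k 1] = z r ^ 2 * θ.1 r (affineCoord r z) k := by
    have h : ∀ m, ![(k 0 : Fin 4), k 1] m ≠ r := fun m => by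
      fin_cases m
      · exact (k 0).2
      · exact (k 1).2
    rw [liftField, dif_pos h]
    congr 2
    refine congrArg (θ.1 r (affineCoord r z)) (funext fun m => ?_)
    fin_cases m <;> rfl
  rw [h1, h1, h2]
  field_simp
  ring

/-- The transformation law of θ between charts, composed with the chain rule for dπ. -/
theorem push_liftField_of_ne (θ : HolMultivector 2) (r s : Fin 4) {z : Fin 4 → ℂ} (hr : z r ≠ 0)
    (hs : z s ≠ 0) :
    pushMultivector (fderiv ℂ (affineCoord s) z) (liftField θ r z) =
      θ.1 s (affineCoord s z) := by
  have hz : z ≠ 0 := by rintro rfl; exact hr rfl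
  have h := θ.2.2.2 r s (Projectivization.mk ℂ z hz)
    ⟨mk_mem_affineOpen r hz hr, mk_mem_affineOpen s hz hs⟩
  rw [chart_mk, chart_mk, ← push_liftField θ r hr, pushMultivector_comp,
    ← fderiv_affineCoord_eq_comp r s hr hs] at h
  exact h.symm

theorem pushMultivector_sub {ι κ : Type} [Fintype ι] [DecidableEq ι] [Fintype κ] {q : ℕ}
    (L : (ι → ℂ) →L[ℂ] (κ → ℂ)) (s t : (Fin q → ι) → ℂ) :
    pushMultivector L (s - t) = pushMultivector L s - pushMultivector L t := by
  funext k
  simp [pushMultivector, mul_sub, Finset.sum_sub_distrib]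

/-- Both lifts have the same image in the chart of U_s, so their difference lies in the kernel of dπ
and is killed by z ∧. This is the gluing step. -/
theorem eulerWedge_liftField_eq (θ : HolMultivector 2) (r s : Fin 4) {z : Fin 4 → ℂ}
    (hr : z r ≠ 0) (hs : z s ≠ 0) :
    eulerWedge z (liftField θ r z) = eulerWedge z (liftField θ s z) := by
  have ha : IsAntisymm (liftField θ r z - liftField θ s z) := by
    rw [sub_eq_add_neg, ← neg_one_smul ℂ (liftField θ s z)]
    refine alternating_add (liftField_isAntisymm θ r z) fun τ k => ?_
    simp only [Pi.smul_apply, smul_eq_mul, liftField_isAntisymm θ s z τ k]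
    ring
  have h := eulerWedge_eq_zero_of_push_two s hs ha (by
    rw [pushMultivector_sub, push_liftField_of_ne θ r s hr hs, push_liftField θ s hs, sub_self])
  funext k
  rw [show k = ![k 0, k 1, k 2] by funext l; fin_cases l <;> rfl]
  have h' := h (k 0) (k 1) (k 2)
  rw [eulerWedge_sub] at h'
  exact sub_eq_zero.1 h'

theorem differentiableAt_liftField (θ : HolMultivector 2) (r : Fin 4) (k : Fin 2 → Fin 4)
    {z : Fin 4 → ℂ} (hr : z r ≠ 0) : DifferentiableAt ℂ (fun y => liftField θ r y k) z := by
  unfold liftField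
  split_ifs with h
  · have h1 : DifferentiableAt ℂ
        (fun y => θ.1 r (affineCoord r y) fun m => (⟨k m, h m⟩ : Idx r)) z :=
      (θ.2.2.1 r _ _).comp z (differentiableAt_affineCoord r hr)
    exact DifferentiableAt.fun_mul (by fun_prop) h1
  · exact differentiableAt_const _

open Classical in
/-- The trivector `z ∧ w` on `ℂ⁴` for the local lifts `w` of a holomorphic bivector on `ℂP³`. -/
noncomputable def wedgeField (θ : HolMultivector 2) (z : Fin 4 → ℂ) : (Fin 3 → Fin 4) → ℂ :=
  if h : ∃ r, z r ≠ 0 then eulerWedge z (liftField θ h.choose z) else 0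

theorem wedgeField_eq (θ : HolMultivector 2) {r : Fin 4} {z : Fin 4 → ℂ} (hr : z r ≠ 0) :
    wedgeField θ z = eulerWedge z (liftField θ r z) := by
  have h : ∃ r, z r ≠ 0 := ⟨r, hr⟩
  rw [wedgeField, dif_pos h, eulerWedge_liftField_eq θ _ r h.choose_spec hr]

theorem wedgeField_zero (θ : HolMultivector 2) : wedgeField θ 0 = 0 := by
  rw [wedgeField, dif_neg (by simp)]

theorem wedgeField_isAntisymm (θ : HolMultivector 2) (z : Fin 4 → ℂ) :
    IsAntisymm (wedgeField θ z) := by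
  unfold wedgeField
  split_ifs
  · exact (liftField_isAntisymm θ _ z).eulerWedge z
  · intro τ k
    simp

theorem wedgeField_smul (θ : HolMultivector 2) {c : ℂ} (hc : c ≠ 0) (z : Fin 4 → ℂ) :
    wedgeField θ (c • z) = c ^ 3 • wedgeField θ z := by
  by_cases hz : z = 0
  · simp [hz, wedgeField_zero]
  obtain ⟨r, hr⟩ := Function.ne_iff.1 hz
  have hr' : (c • z) r ≠ 0 := by simpa [hc] using hr
  rw [wedgeField_eq θ hr, wedgeField_eq θ hr', liftField_smul θ r hc, eulerWedge_smul]
  congr 1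
  ring

theorem differentiable_wedgeField (θ : HolMultivector 2) (k : Fin 3 → Fin 4) :
    Differentiable ℂ fun z => wedgeField θ z k := by
  -- The wedge with z raises the degree to 3, so the estimate at the origin applies; elsewhere one
  -- local lift is used.
  refine differentiable_of_homogeneous (n := 3) (by norm_num) (by rw [wedgeField_zero]; rfl)
    (fun z hz => ?_) fun c z hc => by rw [wedgeField_smul θ hc]; rfl
  obtain ⟨r, hr⟩ := Function.ne_iff.1 hz
  have h : (fun y => wedgeField θ y k) =ᶠ[nhds z] fun y => eulerWedge y (liftField θ r y) k := by
    filter_upwards [(isOpen_apply_ne_zero r).mem_nhds hr] with y hy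
    rw [wedgeField_eq θ hy]
  refine DifferentiableAt.congr_of_eventuallyEq ?_ h
  unfold eulerWedge
  refine DifferentiableAt.fun_sum fun m _ => DifferentiableAt.const_mul
    (DifferentiableAt.fun_mul (by fun_prop) (differentiableAt_liftField θ r _ hr)) _

theorem exists_toField_eq_wedgeField (θ : HolMultivector 2) :
    ∃ b : SymAlt 3, ∀ z, toField b z = wedgeField θ z := by
  choose c hc using fun k => exists_tensorEval_of_homogeneous le_rfl
    (differentiable_wedgeField θ k) fun r z hr => by rw [wedgeField_smul θ hr]; rfl
  -- The arrays chosen coefficient by coefficient need have no symmetry. Projecting them does not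
  -- change the field, whose values are already antisymmetric.
  refine ⟨symAltProj 3 fun i k => c k i, fun z => ?_⟩
  rw [toField_symAltProj, ← (wedgeField_isAntisymm θ z).alternate_eq]
  congr 1
  funext k
  exact (congrFun (hc k) z).symm

theorem eulerWedge_wedgeField (θ : HolMultivector 2) (z : Fin 4 → ℂ) (a b c d : Fin 4) :
    eulerWedge z (wedgeField θ z) ![a, b, c, d] = 0 := by
  by_cases hz : z = 0
  · simp [hz, eulerWedge]
  obtain ⟨r, hr⟩ := Function.ne_iff.1 hz
  rw [wedgeField_eq θ hr]
  simp only [eulerWedge_three, eulerWedge_two]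
  ring

/-- Exactness of z ∧ at trivectors: the divergence identity gives an explicit primitive, with
constant 3/4 from degree over dimension. -/
theorem exists_eulerWedge_toField_eq {b : SymAlt 3}
    (h : ∀ z k l m n, eulerWedge z (toField b z) ![k, l, m, n] = 0) :
    ∃ a : SymAlt 2, ∀ z k l m,
      eulerWedge z (toField a z) ![k, l, m] = toField b z ![k, l, m] := by
  refine ⟨symAltProj 2 ((3 / 4 : ℂ) • contract b), fun z k l m => ?_⟩
  have ha : IsAntisymm fun k => tensorEval (fun i => contract b i k) z := by
    refine isAntisymm_two fun k l => ?_
    have e : (fun i => contract b i ![l, k]) = fun i => (-1 : ℂ) * contract b i ![k, l] := by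
      funext i
      simp only [contract, Finset.mul_sum]
      refine Finset.sum_congr rfl fun n _ => ?_
      have := (SymAlt_isAntisymm b (Fin.cons n i)).swap_three_right n k l
      rw [neg_one_mul]
      exact this
    rw [e, tensorEval_const_mul, neg_one_mul]
  rw [map_smul, toField_const_smul, toField_symAltProj, ha.alternate_eq, eulerWedge_two]
  have := toField_eq_of_eulerWedge_three h z k l m
  simp only [Pi.smul_apply, smul_eq_mul]
  linear_combination -this / 4

/-- In a chart the image of a bivector depends only on its wedge with z, so it suffices that w_a and
the local lift of θ have the same wedge with z. -/
theorem pushforwardMap_two_surjective : Function.Surjective (pushforwardMap 2) := by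
  intro θ
  obtain ⟨b, hb⟩ := exists_toField_eq_wedgeField θ
  obtain ⟨a, ha⟩ := exists_eulerWedge_toField_eq (b := b) fun z k l m n => by
    rw [hb, eulerWedge_wedgeField]
  refine ⟨a, Subtype.ext ?_⟩
  funext r ζ k
  have hr : affineVec r ζ r ≠ 0 := by simp
  have h := congrFun (push_liftField θ r hr) k
  rw [affineCoord_affineVec] at h
  rw [← h, pushforwardMap_coe, pushField,
    pushMultivector_affineCoord_two r hr (toField_isAntisymm a _),
    pushMultivector_affineCoord_two r hr (liftField_isAntisymm θ r _), ha, hb, wedgeField_eq θ hr]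

/-! ### Descent of the bracket -/

theorem schouten_zero_left {ι : Type} [Fintype ι] [DecidableEq ι]
    (η : (ι → ℂ) → (Fin 2 → ι) → ℂ) : schouten 0 η = 0 := by
  funext x k
  simp [schouten, alternate, partialDeriv]

theorem schouten_zero_right {ι : Type} [Fintype ι] [DecidableEq ι]
    (η : (ι → ℂ) → (Fin 2 → ι) → ℂ) : schouten η 0 = 0 := by
  funext x k
  simp [schouten, alternate, partialDeriv]

/-- Membership can be tested by dπ, since the kernel on trivectors is known exactly. There F̃
becomes a bracket with the zero bivector. -/
theorem Ftilde_mem_eulerPart {a a' : SymAlt 2} (h : a ∈ eulerPart 1 ∨ a' ∈ eulerPart 1) :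
    Ftilde a a' ∈ eulerPart 2 := by
  rw [← ker_pushforwardMap_three, LinearMap.mem_ker]
  apply Subtype.ext
  funext r
  have h0 : ∀ a ∈ eulerPart 1, pushField a r = 0 := fun a ha =>
    congrFun (congrArg Subtype.val (LinearMap.mem_ker.1 (eulerPart_le_ker 1 ha))) r
  rw [pushforwardMap_coe, ← schouten_pushField]
  rcases h with h | h
  · rw [h0 a h, schouten_zero_left]
    rfl
  · rw [h0 a' h, schouten_zero_right]
    rfl

/-- The bilinear map `F` on the quotient induced by `F̃`. -/
noncomputable def quotientBracket : (SymAlt 2 ⧸ eulerPart 1) →ₗ[ℂ] (SymAlt 2 ⧸ eulerPart 1) →ₗ[ℂ]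
    (SymAlt 3 ⧸ eulerPart 2) :=
  (Ftilde.compr₂ (eulerPart 2).mkQ).liftQ₂ (eulerPart 1) (eulerPart 1)
    (fun _ ha => LinearMap.ext fun _ =>
      (Submodule.Quotient.mk_eq_zero _).2 (Ftilde_mem_eulerPart (Or.inl ha)))
    (fun _ ha => LinearMap.ext fun _ =>
      (Submodule.Quotient.mk_eq_zero _).2 (Ftilde_mem_eulerPart (Or.inr ha)))

/-- The isomorphism `Φ₂` induced by `a ↦ dπ(w_a)`. -/
noncomputable def bivectorEquiv : (SymAlt 2 ⧸ eulerPart 1) ≃ₗ[ℂ] HolMultivector 2 :=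
  (Submodule.quotEquivOfEq _ _ ker_pushforwardMap_two.symm).trans
    ((pushforwardMap 2).quotKerEquivOfSurjective pushforwardMap_two_surjective)

/-- The embedding `Φ₃` induced by `a ↦ dπ(w_a)`. -/
noncomputable def trivectorMap : (SymAlt 3 ⧸ eulerPart 2) →ₗ[ℂ] HolMultivector 3 :=
  (eulerPart 2).liftQ (pushforwardMap 3) (eulerPart_le_ker 2)

theorem trivectorMap_injective : Function.Injective trivectorMap := by
  rw [← LinearMap.ker_eq_bot]
  exact Submodule.ker_liftQ_eq_bot _ _ _ ker_pushforwardMap_three.le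

theorem schouten_bivectorEquiv (x y : SymAlt 2 ⧸ eulerPart 1) (r : Fin 4) :
    schouten ((bivectorEquiv x).1 r) ((bivectorEquiv y).1 r) =
      (trivectorMap (quotientBracket x y)).1 r := by
  obtain ⟨a, rfl⟩ := Submodule.Quotient.mk_surjective _ x
  obtain ⟨a', rfl⟩ := Submodule.Quotient.mk_surjective _ y
  exact schouten_pushField a a' r

end CP3

/-! ### The theorem -/

theorem propositions3 :
    -- the Schouten bracket of invariant 2-vectors on `ℂ⁴ ∖ {0}` is `F̃`
    (∀ (a a' : CP3.SymAlt 2) (z : Fin 4 → ℂ), z ≠ 0 →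
      CP3.schouten (CP3.toField a) (CP3.toField a') z = CP3.toField (CP3.Ftilde a a') z) ∧
    -- `F̃` descends to the quotients
    ∃ F : (CP3.SymAlt 2 ⧸ CP3.eulerPart 1) →ₗ[ℂ] (CP3.SymAlt 2 ⧸ CP3.eulerPart 1) →ₗ[ℂ]
        (CP3.SymAlt 3 ⧸ CP3.eulerPart 2),
      (∀ a a' : CP3.SymAlt 2,
        F (Submodule.Quotient.mk a) (Submodule.Quotient.mk a') =
          Submodule.Quotient.mk (CP3.Ftilde a a')) ∧
      -- `a ↦ dπ(w_a)` identifies the first quotient with the holomorphic 2-vectors on `ℂP³`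
      -- and embeds the second one into the holomorphic 3-vectors
      ∃ (Φ₂ : (CP3.SymAlt 2 ⧸ CP3.eulerPart 1) ≃ₗ[ℂ] CP3.HolMultivector 2)
        (Φ₃ : (CP3.SymAlt 3 ⧸ CP3.eulerPart 2) →ₗ[ℂ] CP3.HolMultivector 3),
        (∀ a : CP3.SymAlt 2,
          CP3.IsPushforward (CP3.toField a) (Φ₂ (Submodule.Quotient.mk a))) ∧
        (∀ c : CP3.SymAlt 3,
          CP3.IsPushforward (CP3.toField c) (Φ₃ (Submodule.Quotient.mk c))) ∧
        Function.Injective Φ₃ ∧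
        -- under these maps `F` is the Schouten bracket on `ℂP³`
        (∀ (x y : CP3.SymAlt 2 ⧸ CP3.eulerPart 1) (r : Fin 4),
          CP3.schouten ((Φ₂ x).1 r) ((Φ₂ y).1 r) = (Φ₃ (F x y)).1 r) ∧
        -- holomorphic Poisson structures correspond to the zeros of `F(a, a)`
        Φ₂ '' {x | F x x = 0} = {θ | CP3.IsPoisson θ} := by
  refine ⟨fun a a' z _ => CP3.schouten_toField a a' z, CP3.quotientBracket, fun a a' => rfl,
    CP3.bivectorEquiv, CP3.trivectorMap, CP3.isPushforward_pushforwardMap,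
    CP3.isPushforward_pushforwardMap, CP3.trivectorMap_injective, CP3.schouten_bivectorEquiv, ?_⟩
  ext θ
  obtain ⟨x, rfl⟩ := CP3.bivectorEquiv.surjective θ
  -- The bracket of the image of x with itself is Φ₃(F(x, x)) in every chart, so injectivity of Φ₃
  -- gives the equivalence.
  have h : CP3.IsPoisson (CP3.bivectorEquiv x) ↔ CP3.quotientBracket x x = 0 := by
    rw [← CP3.trivectorMap_injective.eq_iff, map_zero, Subtype.ext_iff, funext_iff]
    exact forall_congr' fun r => by rw [CP3.schouten_bivectorEquiv]; rfl
  rw [Set.mem_ofPred_eq, h]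
  exact CP3.bivectorEquiv.injective.mem_set_image
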